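/- Let $n\ge 0$. Faces of dimension $n$ are the faces with $n+1$ vertices of a simplicial complex, respectively the nondegenerate $n$-simplices of a simplicial set; a simplicial complex or simplicial set is said to be homeomorphic to a space if its geometric realization is (a simplicial complex being realized with the weak topology). A simplicial set $X$ is called regular if for every nondegenerate simplex $x\in X_n$ with $n\ge 1$ the subcomplex generated by $x$ is the pushout of $\Delta^n\xleftarrow{\ \delta^n\ }\Delta^{n-1}\to\langle d_nx\rangle$, i.e. the characteristic map $\Delta^n\to X$ of $x$ is injective except for possible identifications inside the last face. In particular, $X$ is regular if all its nondegenerate simplices (equivalently, the boundaries of all of them) are embedded. (i) Every simplicial complex, and every regular simplicial set, that is homeomorphic to the $n$-torus $(S^1)^n$ or to the real projective space $\mathbb{R}P^n$ has at least $2^n$ faces of dimension $n$. (ii) For regular simplicial sets and $\mathbb{R}P^n$ this bound is sharp. Let $\Diamond=\operatorname{conv}\{\pm e_0,\dots,\pm e_n\}\subset\mathbb{R}^{n+1}$ be the $(n+1)$-dimensional crosspolytope, and let $S$ be the simplicial set whose $m$-simplices are the sequences $(\varepsilon_0e_{i_0},\dots,\varepsilon_me_{i_m})$ of vertices with $i_0\le\dots\le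 i_m$ in which consecutive vertices with equal index coincide. The map that sends each vertex to itself and is affine on each simplex is a homeomorphism $\Phi:|S|\to\partial\Diamond$. Let $Q$ be the quotient of $S$ by the antipodal map $v\mapsto -v$, with quotient map $\pi:S\to Q$. Then $Q$ is a regular simplicial set, all of its nondegenerate simplices are even embedded, there is a homeomorphism $\Psi:|Q|\to\mathbb{R}P^n$ such that $\Psi(|\pi|(p))$ is the line spanned by $\Phi(p)$ for every $p\in|S|$, and $Q$ has exactly $2^n$ faces of dimension $n$. -/

import Mathlib

open CategoryTheory Simplicial Opposite

universe u v

noncomputable section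

/-! ### Model spaces -/

/-- The `n`-torus `(S¹)ⁿ`. -/
abbrev Torus (n : ℕ) : Type := Fin n → Circle

/-- Real projective `n`-space: the lines through the origin of `ℝⁿ⁺¹`. -/
def RealProjectiveSpace (n : ℕ) : Type := Projectivization ℝ (Fin (n + 1) → ℝ)

/-- `ℝPⁿ` carries the quotient topology of `ℝⁿ⁺¹ ∖ {0}`. -/
instance RealProjectiveSpace.instTopologicalSpace (n : ℕ) :
    TopologicalSpace (RealProjectiveSpace n) :=
  TopologicalSpace.coinduced
    (fun v : {v : Fin (n + 1) → ℝ // v ≠ 0} => Projectivization.mk' ℝ v) inferInstance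

/-- The line of `ℝⁿ⁺¹` which a point of `ℝPⁿ` is. -/
def RealProjectiveSpace.line {n : ℕ} (p : RealProjectiveSpace n) :
    Submodule ℝ (Fin (n + 1) → ℝ) :=
  Projectivization.submodule (K := ℝ) (V := Fin (n + 1) → ℝ) p

/-! ### Simplicial complexes and their geometric realization -/

namespace AbstractSimplicialComplex

variable {V : Type v}

/-- The points of the geometric realization of a simplicial complex: barycentric coordinates
which are supported on a face. -/
def Realization (K : AbstractSimplicialComplex V) : Type v :=
  {t : V → ℝ // (∀ a, 0 ≤ t a) ∧ ∃ s ∈ K.faces, (∀ a, a ∉ s → t a = 0) ∧ ∑ a ∈ s, t a = 1}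

/-- The closed geometric simplex of the realization spanned by the vertices in `s`. -/
def closedSimplex (K : AbstractSimplicialComplex V) (s : Finset V) : Set K.Realization :=
  {p | ∀ a, a ∉ s → p.1 a = 0}

/-- The weak topology: a set is open if and only if its trace on each closed simplex is open, a
closed simplex having the Euclidean topology of its (finitely many) barycentric coordinates. -/
instance Realization.instTopologicalSpace (K : AbstractSimplicialComplex V) :
    TopologicalSpace K.Realization :=
  ⨆ s : K.faces, TopologicalSpace.coinduced
    (Subtype.val : K.closedSimplex s.1 → K.Realization)
    (TopologicalSpace.induced (fun p : K.closedSimplex s.1 => (p.1.1 : V → ℝ)) inferInstance)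

/-- The faces of dimension `n` of a simplicial complex. -/
def facesOfDim (K : AbstractSimplicialComplex V) (n : ℕ) : Set (Finset V) :=
  {s | s ∈ K.faces ∧ s.card = n + 1}

end AbstractSimplicialComplex

/-! ### Regular simplicial sets -/

namespace SSet

/-- A simplicial set is *regular* if, for each nondegenerate `n`-simplex `x`, its characteristic
map `Δ[n] ⟶ X` identifies no simplices of `Δ[n]` except simplices of the last face (the one
opposite to the last vertex) with each other. Equivalently, the subcomplex generated by `x` is the
pushout of `Δ[n] ⟵ Δ[n-1] ⟶ ⟨d_n x⟩`. -/
class IsRegular (X : SSet.{u}) : Prop where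
  eq_or_lastFace {n : ℕ} (x : X _⦋n⦌) (hx : x ∈ X.nonDegenerate n) {m : ℕ} (f g : ⦋m⦌ ⟶ ⦋n⦌)
    (h : X.map f.op x = X.map g.op x) :
    f = g ∨ ((∀ i, f.toOrderHom i ≠ Fin.last n) ∧ (∀ i, g.toOrderHom i ≠ Fin.last n))

/-- A simplicial set whose nondegenerate simplices are all embedded is regular. -/
theorem IsRegular.of_nonsingular (X : SSet.{u}) [X.Nonsingular] : X.IsRegular where
  eq_or_lastFace {n} x hx {m} f g h := by
    left
    have hm : Mono (yonedaEquiv.symm x) := Nonsingular.mono' x hx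
    have hinj : Function.Injective ((yonedaEquiv.symm x).app (op ⦋m⦌)) :=
      (CategoryTheory.mono_iff_injective _).1 inferInstance
    exact stdSimplex.objEquiv.symm.injective (hinj h)

/-- The point with barycentric coordinates `t` of the simplex `x`, in the geometric realization. -/
def realizationPoint (X : SSet.{0}) {m : ℕ} (x : X _⦋m⦌) (t : _root_.stdSimplex ℝ (Fin (m + 1))) :
    SSet.toTop.obj X :=
  (SSet.toTopSimplex.inv.app ⦋m⦌ ≫ SSet.toTop.map (yonedaEquiv.symm x)) (ULift.up t)

end SSet

/-! ### The crosspolytope, its boundary complex, and the antipodal quotient -/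

/-- The `d`-dimensional crosspolytope in `ℝᵈ`, with vertices `±eᵢ`. -/
def crosspolytope (d : ℕ) : Set (Fin d → ℝ) :=
  convexHull ℝ {v | ∃ i, v = Pi.single i 1 ∨ v = -Pi.single i 1}

/-- The vertices `sign • e_index` of the `(n+1)`-dimensional crosspolytope. -/
@[ext]
structure CrossVertex (n : ℕ) : Type where
  index : Fin (n + 1)
  sign : ℤˣ

namespace CrossVertex

variable {n : ℕ}

/-- The vertex as a vector of `ℝⁿ⁺¹`. -/
def vec (a : CrossVertex n) : Fin (n + 1) → ℝ := Pi.single a.index ((a.sign : ℤ) : ℝ)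

/-- The vertices are ordered by their index, so that two distinct vertices are comparable if and
only if they are not antipodal, that is, if and only if they span an edge. -/
instance : PartialOrder (CrossVertex n) where
  le a b := a = b ∨ a.index < b.index
  le_refl a := Or.inl rfl
  le_trans a b c := by
    rintro (rfl | h) (rfl | h')
    · exact Or.inl rfl
    · exact Or.inr h'
    · exact Or.inr h
    · exact Or.inr (h.trans h')
  le_antisymm a b := by
    rintro (rfl | h) (h' | h')
    · rfl
    · rfl
    · exact h'.symm
    · exact absurd h' h.asymm

/-- The antipodal vertex. -/
def antipode (a : CrossVertex n) : CrossVertex n := ⟨a.index, -a.sign⟩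

theorem antipode_monotone : Monotone (antipode : CrossVertex n → CrossVertex n) := by
  rintro a b (rfl | h)
  · exact Or.inl rfl
  · exact Or.inr h

end CrossVertex

/-- The boundary of the `(n+1)`-dimensional crosspolytope as a simplicial set. The faces of the
boundary are spanned by the sets of vertices without antipodal pairs, that is, by the chains of
`CrossVertex n`; an `m`-simplex is a weakly increasing sequence of `m + 1` vertices. -/
abbrev crossBoundary (n : ℕ) : SSet.{0} := nerve (CrossVertex n)

/-- The antipodal map of the boundary of the crosspolytope. -/
def crossAntipode (n : ℕ) : crossBoundary n ⟶ crossBoundary n :=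
  nerveMap (CrossVertex.antipode_monotone (n := n)).functor

/-- The simplicial set obtained from the boundary of the `(n+1)`-dimensional crosspolytope by
identifying antipodal simplices. -/
def crossQuotient (n : ℕ) : SSet.{0} where
  obj m := Quot fun x y : (crossBoundary n).obj m => y = (crossAntipode n).app m x
  map f := ↾(Quot.map ((crossBoundary n).map f) (by
    rintro x y rfl
    exact (NatTrans.naturality_apply (crossAntipode n) f x).symm))
  map_id m := by
    ext x
    induction x using Quot.ind
    rfl
  map_comp f g := by
    ext x
    induction x using Quot.ind
    rfl

/-- The quotient map. -/
def crossQuotientMap (n : ℕ) : crossBoundary n ⟶ crossQuotient n where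
  app _ := ↾(Quot.mk _)
  naturality _ _ _ := rfl

end

-- The torus and `ℝPⁿ` carry `n` real line bundles whose continuous sections always have a common
-- zero: on `ℝPⁿ` the tautological bundle taken `n` times, on the torus the Möbius bundles of the
-- circle factors. Behind this is a nonzero product of `n` classes `w₁` modulo 2; the argument uses
-- only the common zero.
--
-- Suppose that the space is glued from simplices. Choose, arbitrarily and discontinuously, a unit
-- vector in each line. Over a simplex each bundle is trivial, so the vectors of the `i`-th bundle
-- give signs to the vertices, up to one global sign. The barycentric coordinates of a point cut
-- `[0, 1]` into intervals, one for each vertex; averaging the `i`-th signs over the block `[i/n,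
-- (i+1)/n]` yields a continuous section of the `i`-th bundle. At a common zero each block meets
-- both signs, so vertices `w₀ < ⋯ < wₙ` can be picked for which the `i`-th sign changes from `wᵢ`
-- to `wᵢ₊₁` (`SimplexAtlas.exists_alternating`). Every choice of vectors therefore has an
-- alternating `n`-face.
--
-- Counting finishes the bound (`two_pow_le_card_of_forall_signs`). Alternation in the `i`-th bundle
-- relates the vectors at the two ends of one edge and is destroyed by reversing either of them. If
-- the two ends are different points, the vectors of one bundle can be chosen so that at most half
-- of the remaining faces alternate. One face survives `n` halvings, so there were at least `2 ^ n`.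
-- Regularity of a simplicial set enters only to separate the two ends
-- (`SSet.HasNonconstantEdges.vtx_ne`).
--
-- The common zeros come from a Tucker-type lemma on a cubical grid: the parity of the flags along
-- which the `i`-th step changes the `i`-th label depends only on the boundary symmetry of the
-- labels (`flagCount_eq`), and is odd for one explicit labelling. Refining the grid and passing to
-- a limit turns sign changes into zeros.
--
-- For sharpness, a facet of the crosspolytope boundary is a sign vector in `{±1}ⁿ⁺¹`, and the
-- antipodal map identifies these in pairs. The index of a vertex survives in the quotient and is
-- strictly increasing along a nondegenerate simplex, which makes all simplices embedded.

universe w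

/-! ### A parity count of flags in a cubical grid -/

/-- The edges of the subdivided interval `[-N, N]`, directed from the even to the odd endpoint. -/
noncomputable def evenOddEdges (N : ℕ) : Finset (ℤ × ℤ) :=
  (Finset.Icc (-(N : ℤ)) N ×ˢ Finset.Icc (-(N : ℤ)) N).filter
    fun e => Even e.1 ∧ (e.2 = e.1 + 1 ∨ e.2 = e.1 - 1)

theorem mem_evenOddEdges {N : ℕ} {e : ℤ × ℤ} :
    e ∈ evenOddEdges N ↔ ((-(N : ℤ) ≤ e.1 ∧ e.1 ≤ N) ∧ (-(N : ℤ) ≤ e.2 ∧ e.2 ≤ N)) ∧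
      Even e.1 ∧ (e.2 = e.1 + 1 ∨ e.2 = e.1 - 1) := by
  simp [evenOddEdges]

/-- The maximal flags of the triangulation of `[-N, N]ⁿ` by the product order in which the even
endpoint of an edge precedes the odd one: an edge in each direction, and the position at which
each coordinate moves from the even to the odd endpoint of its edge. -/
noncomputable def gridFlags (n N : ℕ) : Finset ((Fin n → ℤ × ℤ) × Equiv.Perm (Fin n)) :=
  (Fintype.piFinset fun _ => evenOddEdges N) ×ˢ Finset.univ

/-- The `k`-th vertex of a flag. -/
def flagVertex {n : ℕ} (φ : (Fin n → ℤ × ℤ) × Equiv.Perm (Fin n)) (k : ℕ) : Fin n → ℤ :=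
  fun j => if (φ.2 j : ℕ) < k then (φ.1 j).2 else (φ.1 j).1

theorem mem_gridFlags {n N : ℕ} {φ : (Fin n → ℤ × ℤ) × Equiv.Perm (Fin n)} :
    φ ∈ gridFlags n N ↔ ∀ j, φ.1 j ∈ evenOddEdges N := by
  simp [gridFlags]

theorem abs_flagVertex_le {n N : ℕ} {φ : (Fin n → ℤ × ℤ) × Equiv.Perm (Fin n)}
    (hφ : φ ∈ gridFlags n N) (k : ℕ) (j : Fin n) : |flagVertex φ k j| ≤ N := by
  have := mem_evenOddEdges.1 (mem_gridFlags.1 hφ j)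
  rw [abs_le]
  unfold flagVertex
  split_ifs <;> omega

/-! ### Pairing the flags that agree after one vertex is forgotten -/

/-- Exchanging the steps before and after the `k`-th vertex changes that vertex only, so the flags
cancel in pairs. -/
theorem sum_gridFlags_eq_zero_of_interior {n N k : ℕ} (hk : 0 < k) (hkn : k < n)
    (G : (ℕ → Fin n → ℤ) → ZMod 2)
    (hG : ∀ y y', (∀ m, m ≠ k → y m = y' m) → G y = G y') :
    ∑ φ ∈ gridFlags n N, G (flagVertex φ) = 0 := by
  let p : Fin n := ⟨k - 1, by omega⟩
  let q : Fin n := ⟨k, hkn⟩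
  have hpq : p ≠ q := by simp only [p, q, ne_eq, Fin.mk.injEq]; omega
  refine Finset.sum_involution (fun φ _ => (φ.1, Equiv.swap p q * φ.2)) ?_ ?_ ?_ ?_
  · intro φ _
    rw [hG (flagVertex (φ.1, Equiv.swap p q * φ.2)) (flagVertex φ), CharTwo.add_self_eq_zero]
    intro m hm
    funext j
    have : ((Equiv.swap p q (φ.2 j) : Fin n) : ℕ) < m ↔ (φ.2 j : ℕ) < m := by
      rcases eq_or_ne (φ.2 j) p with h | h
      · rw [h, Equiv.swap_apply_left]
        simp only [p, q]; omega
      rcases eq_or_ne (φ.2 j) q with h' | h'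
      · rw [h', Equiv.swap_apply_right]
        simp only [p, q]; omega
      rw [Equiv.swap_apply_of_ne_of_ne h h']
    simp only [flagVertex, Equiv.Perm.mul_apply, this]
  · intro φ _ _ h
    have := congrArg (fun e => e.2 (φ.2.symm p)) h
    simp only [Equiv.Perm.mul_apply, Equiv.apply_symm_apply, Equiv.swap_apply_left] at this
    exact hpq this.symm
  · intro φ hφ
    exact mem_gridFlags.2 fun j => mem_gridFlags.1 hφ j
  · intro φ _
    simp [← mul_assoc]

/-- In the coordinate that moves first, the even endpoint is reflected in the odd one. Since `N` is
even, the odd endpoint is not `±N`, so the reflected edge stays in the grid and no boundary term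
arises. -/
theorem sum_gridFlags_eq_zero_of_first {n N : ℕ} (hn : 0 < n) (hN : Even N)
    (G : (ℕ → Fin n → ℤ) → ZMod 2)
    (hG : ∀ y y', (∀ m, m ≠ 0 → y m = y' m) → G y = G y') :
    ∑ φ ∈ gridFlags n N, G (flagVertex φ) = 0 := by
  let p : Fin n := ⟨0, hn⟩
  refine Finset.sum_involution (fun φ _ => (Function.update φ.1 (φ.2.symm p)
    (2 * (φ.1 (φ.2.symm p)).2 - (φ.1 (φ.2.symm p)).1, (φ.1 (φ.2.symm p)).2), φ.2)) ?_ ?_ ?_ ?_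
  · intro φ _
    refine (congrArg (G (flagVertex φ) + ·) (hG _ (flagVertex φ) fun m hm => ?_)).trans
      (CharTwo.add_self_eq_zero _)
    funext j
    rcases eq_or_ne j (φ.2.symm p) with rfl | h
    · simp [flagVertex, p, Nat.pos_of_ne_zero hm]
    · simp [flagVertex, h]
  · intro φ hφ _ h
    have := congrArg (fun e => (e.1 (φ.2.symm p)).1) h
    simp only [Function.update_self] at this
    have := (mem_evenOddEdges.1 (mem_gridFlags.1 hφ (φ.2.symm p))).2.2
    omega
  · intro φ hφ
    refine mem_gridFlags.2 fun j => ?_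
    rcases eq_or_ne j (φ.2.symm p) with rfl | h
    · have h := mem_evenOddEdges.1 (mem_gridFlags.1 hφ (φ.2.symm p))
      simp only [Function.update_self]
      rw [mem_evenOddEdges]
      obtain ⟨r, hr⟩ := hN
      obtain ⟨h1, ⟨t, ht⟩, h2⟩ := h
      refine ⟨⟨?_, ?_⟩, ?_, ?_⟩
      · simp only; omega
      · simp only; omega
      · simp only; exact ⟨(φ.1 (φ.2.symm p)).2 - t, by omega⟩
      · simp only; omega
    · simpa [h] using mem_gridFlags.1 hφ j
  · intro φ _
    refine Prod.ext (funext fun j => ?_) rfl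
    rcases eq_or_ne j (φ.2.symm p) with rfl | h
    · simp
    · simp [h]

/-- Negate the coordinates in a set `s`. -/
def negOn {n : ℕ} (s : Finset (Fin n)) (p : Fin n → ℤ) : Fin n → ℤ :=
  fun j => if j ∈ s then -p j else p j

/-- In the coordinate `j` that moves last, the odd endpoint is reflected in the even one. This fails
only if the even endpoint is `±N`; then the vertices before the last all lie on `|p j| = N`, and the
flag is paired with its image under the negation `A j`. The hypothesis `j ∈ A j` makes this image a
different flag and keeps it in the same boundary case. -/
theorem sum_gridFlags_eq_zero_of_last {n N : ℕ} (hn : 0 < n) (hN : 0 < N)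
    (A : Fin n → Finset (Fin n)) (hA : ∀ j, j ∈ A j)
    (G : (ℕ → Fin n → ℤ) → ZMod 2)
    (hG : ∀ y y', (∀ m, m < n → y m = y' m) → G y = G y')
    (hG' : ∀ (j : Fin n) (y : ℕ → Fin n → ℤ), (∀ m, m < n → |y m j| = N) →
      (∀ m i, |y m i| ≤ N) → G (fun m => negOn (A j) (y m)) = G y) :
    ∑ φ ∈ gridFlags n N, G (flagVertex φ) = 0 := by
  let q : Fin n := ⟨n - 1, by omega⟩
  refine Finset.sum_involution (fun φ _ =>
    if |(φ.1 (φ.2.symm q)).1| = N then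
      (fun j => if j ∈ A (φ.2.symm q) then (-(φ.1 j).1, -(φ.1 j).2) else φ.1 j, φ.2)
    else (Function.update φ.1 (φ.2.symm q)
      ((φ.1 (φ.2.symm q)).1, 2 * (φ.1 (φ.2.symm q)).1 - (φ.1 (φ.2.symm q)).2), φ.2)) ?_ ?_ ?_ ?_
  · intro φ hφ
    split_ifs with hb
    · rw [show flagVertex (fun j => if j ∈ A (φ.2.symm q) then (-(φ.1 j).1, -(φ.1 j).2)
        else φ.1 j, φ.2) = fun m => negOn (A (φ.2.symm q)) (flagVertex φ m) from ?_, hG',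
        CharTwo.add_self_eq_zero]
      · intro m hm
        have : ¬ (n - 1 < m) := by omega
        simp [flagVertex, q, this, hb]
      · intro m i
        exact abs_flagVertex_le hφ m i
      · funext m j
        simp only [flagVertex, negOn]
        split_ifs <;> rfl
    · refine (congrArg (G (flagVertex φ) + ·) (hG _ (flagVertex φ) fun m hm => ?_)).trans
        (CharTwo.add_self_eq_zero _)
      funext j
      rcases eq_or_ne j (φ.2.symm q) with rfl | h
      · have : ¬ (n - 1 < m) := by omega
        simp [flagVertex, q, this]
      · simp [flagVertex, h]
  · intro φ hφ _ h
    split_ifs at h with hb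
    · have := congrArg (fun e => (e.1 (φ.2.symm q)).1) h
      simp only [hA, if_true] at this
      have h0 : (φ.1 (φ.2.symm q)).1 = 0 := by omega
      simp [h0] at hb
      omega
    · have := congrArg (fun e => (e.1 (φ.2.symm q)).2) h
      simp only [Function.update_self] at this
      have := (mem_evenOddEdges.1 (mem_gridFlags.1 hφ (φ.2.symm q))).2.2
      omega
  · intro φ hφ
    split_ifs with hb
    · refine mem_gridFlags.2 fun j => ?_
      have h := mem_evenOddEdges.1 (mem_gridFlags.1 hφ j)
      simp only
      split_ifs
      · rw [mem_evenOddEdges]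
        refine ⟨⟨?_, ?_⟩, ?_, ?_⟩
        · simp only; omega
        · simp only; omega
        · simpa using h.2.1
        · simp only; omega
      · exact mem_gridFlags.1 hφ j
    · refine mem_gridFlags.2 fun j => ?_
      rcases eq_or_ne j (φ.2.symm q) with rfl | h
      · have h := mem_evenOddEdges.1 (mem_gridFlags.1 hφ (φ.2.symm q))
        simp only [Function.update_self]
        rw [mem_evenOddEdges]
        rw [abs_eq (Int.natCast_nonneg N), not_or] at hb
        refine ⟨⟨?_, ?_⟩, h.2.1, ?_⟩
        · simp only; omega
        · simp only; omega
        · simp only; omega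
      · simpa [h] using mem_gridFlags.1 hφ j
  · intro φ hφ
    by_cases hb : |(φ.1 (φ.2.symm q)).1| = N
    · simp only [hb, if_true, hA, abs_neg]
      refine Prod.ext (funext fun j => ?_) rfl
      simp only
      split_ifs <;> simp
    · simp only [hb, if_false, Function.update_self]
      refine Prod.ext (funext fun j => ?_) rfl
      rcases eq_or_ne j (φ.2.symm q) with rfl | h
      · simp
      · simp [h]

/-- The number modulo two of flags along which the `i`-th step changes the `i`-th label. -/
noncomputable def flagCount {n : ℕ} (N : ℕ) (f : Fin n → (Fin n → ℤ) → ZMod 2) : ZMod 2 :=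
  ∑ φ ∈ gridFlags n N, ∏ i : Fin n, (f i (flagVertex φ i) + f i (flagVertex φ (i + 1)))

/-- The labels of boundary points change in a prescribed way when certain coordinates are negated. -/
def BoundaryEquivariant {n : ℕ} (N : ℕ) (A : Fin n → Finset (Fin n)) (δ : Fin n → Fin n → ZMod 2)
    (f : Fin n → (Fin n → ℤ) → ZMod 2) : Prop :=
  ∀ i j (p : Fin n → ℤ), (∀ k, |p k| ≤ N) → |p j| = N → f i (negOn (A j) p) = f i p + δ i j

/-! ### Invariance of the flag count -/

/-- With `flagCount_stokes_right`, this is the vanishing of the integral of a coboundary. The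
factors before the `i`-th are shifted one vertex forward, one at a time, until vertex `0` is free.
-/
theorem flagCount_stokes_left {n N : ℕ} (hN : Even N) (f : Fin n → (Fin n → ℤ) → ZMod 2)
    (h : (Fin n → ℤ) → ZMod 2) (i : Fin n) :
    ∑ φ ∈ gridFlags n N, (∏ j : Fin n, if j = i then h (flagVertex φ (i + 1)) else
      f j (flagVertex φ j) + f j (flagVertex φ (j + 1))) = 0 := by
  -- The factors with `k ≤ j < i` are already shifted: `k = i` is the given product, and `k = 0`
  -- does not involve vertex `0`.
  let B (k : ℕ) (y : ℕ → Fin n → ℤ) (j : Fin n) : ZMod 2 :=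
    if j = i then h (y (i + 1)) else
    if k ≤ j ∧ j < i then f j (y (j + 1)) + f j (y (j + 2)) else f j (y j) + f j (y (j + 1))
  have key : ∀ k : ℕ, k ≤ i → ∑ φ ∈ gridFlags n N, ∏ j, B k (flagVertex φ) j = 0 := by
    intro k
    induction k with
    | zero =>
      intro _
      refine sum_gridFlags_eq_zero_of_first i.pos hN (fun y => ∏ j, B 0 y j) ?_
      intro y y' hy
      refine Finset.prod_congr rfl fun j _ => ?_
      simp only [B]
      split_ifs with h1 h2
      · rw [hy _ (by omega)]
      · rw [hy _ (by omega), hy _ (by omega)]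
      · have : (j : ℕ) ≠ i := fun h => h1 (Fin.ext h)
        have : ¬ (j : ℕ) < i := fun h => h2 ⟨Nat.zero_le _, h⟩
        rw [hy _ (by omega), hy _ (by omega)]
    | succ k ih =>
      intro hk
      suffices e : ∑ φ ∈ gridFlags n N, ∏ j, B (k + 1) (flagVertex φ) j +
          ∑ φ ∈ gridFlags n N, ∏ j, B k (flagVertex φ) j = 0 by
        rwa [ih (by omega), add_zero] at e
      rw [← Finset.sum_add_distrib]
      let q : Fin n := ⟨k, by omega⟩
      have hq : q < i := by simp only [q, Fin.lt_def]; omega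
      -- Two successive products differ in the factor `k` only. Modulo 2 the terms at vertex `k + 1`
      -- cancel, and no other factor involves this vertex.
      let G (y : ℕ → Fin n → ℤ) : ZMod 2 :=
        ∏ j, if j = q then f j (y k) + f j (y (k + 2)) else B (k + 1) y j
      refine (Finset.sum_congr rfl fun φ _ => ?_).trans
        (sum_gridFlags_eq_zero_of_interior (k := k + 1) (by omega) (by omega) G ?_)
      · refine Finset.prod_add_prod_eq (Finset.mem_univ q) ?_ ?_ ?_
        · have h1 : q ≠ i := hq.ne
          have h2 : ((k : ℕ) : ℕ) < i := by omega
          simp only [B, h1, if_false, if_true, q, Fin.lt_def, h2, le_refl, and_self]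
          rw [if_neg (by omega)]
          linear_combination CharTwo.add_self_eq_zero (f q (flagVertex φ (k + 1)))
        · intro j _ hj
          simp [hj]
        · intro j _ hj
          have : (j : ℕ) ≠ k := fun h => hj (Fin.ext h)
          have : k ≤ (j : ℕ) ↔ k + 1 ≤ j := by omega
          simp only [hj, if_false, B, this]
      · intro y y' hy
        refine Finset.prod_congr rfl fun j _ => ?_
        simp only [B]
        split_ifs with h1 h2 h3
        · rw [hy _ (by omega), hy _ (by omega)]
        · rw [hy _ (by omega)]
        · rw [hy _ (by omega), hy _ (by omega)]
        · have : (j : ℕ) ≠ k := fun h => h1 (Fin.ext h)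
          have : (j : ℕ) ≠ i := fun h => h2 (Fin.ext h)
          have : ¬ (k + 1 ≤ (j : ℕ) ∧ (j : ℕ) < i) := h3
          rw [hy _ (by omega), hy _ (by omega)]
  rw [← key i le_rfl]
  refine Finset.sum_congr rfl fun φ _ => Finset.prod_congr rfl fun j _ => ?_
  simp only [B]
  rw [if_neg (show ¬ ((i : ℕ) ≤ j ∧ j < i) by rw [Fin.lt_def]; omega)]

/-- The mirror image: the factors after the `i`-th are shifted backward until vertex `n` is free.
Differences of labels are invariant under the boundary negations because the increments `δ` cancel,
and `h` is invariant by hypothesis. -/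
theorem flagCount_stokes_right {n N : ℕ} (hN : 0 < N) {A : Fin n → Finset (Fin n)}
    (hA : ∀ j, j ∈ A j) {δ : Fin n → Fin n → ZMod 2} {f : Fin n → (Fin n → ℤ) → ZMod 2}
    (hf : BoundaryEquivariant N A δ f)
    {h : (Fin n → ℤ) → ZMod 2} (hh : ∀ j (p : Fin n → ℤ), (∀ k, |p k| ≤ N) → |p j| = N → h (negOn (A j) p) = h p)
    (i : Fin n) :
    ∑ φ ∈ gridFlags n N, (∏ j : Fin n, if j = i then h (flagVertex φ i) else
      f j (flagVertex φ j) + f j (flagVertex φ (j + 1))) = 0 := by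
  -- The factors with `i < j ≤ k` are shifted backward: `k = i` is the given product, and `k = n -
  -- 1` does not involve vertex `n`.
  let C (k : ℕ) (y : ℕ → Fin n → ℤ) (j : Fin n) : ZMod 2 :=
    if j = i then h (y i) else
    if (j : ℕ) < i ∨ k < j then f j (y j) + f j (y (j + 1)) else f j (y (j - 1)) + f j (y j)
  have key : ∀ d k : ℕ, k + d + 1 = n → i ≤ k →
      ∑ φ ∈ gridFlags n N, ∏ j, C k (flagVertex φ) j = 0 := by
    intro d
    induction d with
    | zero =>
      intro k hk hik
      refine sum_gridFlags_eq_zero_of_last i.pos hN A hA (fun y => ∏ j, C k y j) ?_ ?_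
      · intro y y' hy
        refine Finset.prod_congr rfl fun j _ => ?_
        simp only [C]
        split_ifs with h1 h2
        · rw [hy _ (by omega)]
        · rw [hy _ (by omega), hy _ (by omega)]
        · rw [hy _ (by omega), hy _ (by omega)]
      · intro j₀ y hy hy'
        have hf' (j m m') (hm : m < n) (hm' : m' < n) :
            f j (negOn (A j₀) (y m)) + f j (negOn (A j₀) (y m')) = f j (y m) + f j (y m') := by
          rw [hf _ _ _ (hy' m) (hy m hm), hf _ _ _ (hy' m') (hy m' hm')]
          linear_combination CharTwo.add_self_eq_zero (δ j j₀)
        refine Finset.prod_congr rfl fun j _ => ?_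
        simp only [C]
        split_ifs with h1 h2
        · rw [hh _ _ (hy' i) (hy i i.2)]
        · rw [hf' _ _ _ (by omega) (by omega)]
        · rw [hf' _ _ _ (by omega) (by omega)]
    | succ d ih =>
      intro k hk hik
      suffices e : ∑ φ ∈ gridFlags n N, ∏ j, C k (flagVertex φ) j +
          ∑ φ ∈ gridFlags n N, ∏ j, C (k + 1) (flagVertex φ) j = 0 by
        rwa [ih (k + 1) (by omega) (by omega), add_zero] at e
      rw [← Finset.sum_add_distrib]
      let q : Fin n := ⟨k + 1, by omega⟩
      let G (y : ℕ → Fin n → ℤ) : ZMod 2 :=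
        ∏ j, if j = q then f j (y k) + f j (y (k + 2)) else C k y j
      refine (Finset.sum_congr rfl fun φ _ => ?_).trans
        (sum_gridFlags_eq_zero_of_interior (N := N) (k := k + 1) (by omega) (by omega) G ?_)
      · refine Finset.prod_add_prod_eq (Finset.mem_univ q) ?_ ?_ ?_
        · have h1 : q ≠ i := fun h => by have := congrArg Fin.val h; simp only [q] at this; omega
          have h2 : ¬ k + 1 < i := by omega
          simp only [C, h1, if_false, if_true, q, h2, false_or, lt_add_iff_pos_right, zero_lt_one,
            lt_self_iff_false, Nat.add_sub_cancel]
          linear_combination CharTwo.add_self_eq_zero (f q (flagVertex φ (k + 1)))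
        · intro j _ hj
          simp [hj]
        · intro j _ hj
          have : (j : ℕ) ≠ k + 1 := fun h => hj (Fin.ext h)
          have : k < (j : ℕ) ↔ k + 1 < j := by omega
          simp only [hj, if_false, C, this]
      · intro y y' hy
        refine Finset.prod_congr rfl fun j _ => ?_
        simp only [C]
        split_ifs with h1 h2 h3
        · rw [hy _ (by omega), hy _ (by omega)]
        · rw [hy _ (by omega)]
        · have : (j : ℕ) ≠ k + 1 := fun h => h1 (Fin.ext h)
          rw [hy _ (by omega), hy _ (by omega)]
        · rw [hy _ (by omega), hy _ (by omega)]
  rw [← key (n - 1 - i) i (by omega) le_rfl]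
  refine Finset.sum_congr rfl fun φ _ => Finset.prod_congr rfl fun j _ => ?_
  simp only [C]
  split_ifs with h1 h2
  · rfl
  · rfl
  · exact absurd (Fin.ext (by omega)) h1

/-- The two counts differ by the count with `h = f i + g i` as the `i`-th label. Since `f` and `g`
have the same increments `δ`, `h` is invariant on the boundary, and the two Stokes sums, with `h` at
vertex `i + 1` and at vertex `i`, vanish. -/
theorem flagCount_eq_of_eq_off {n N : ℕ} (hN : 0 < N) (hN' : Even N) {A : Fin n → Finset (Fin n)}
    (hA : ∀ j, j ∈ A j) {δ : Fin n → Fin n → ZMod 2} {f g : Fin n → (Fin n → ℤ) → ZMod 2}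
    (hf : BoundaryEquivariant N A δ f) (hg : BoundaryEquivariant N A δ g) (i : Fin n)
    (hfg : ∀ j, j ≠ i → f j = g j) : flagCount N f = flagCount N g := by
  have h1 := flagCount_stokes_left hN' f (f i + g i) i
  have h2 := flagCount_stokes_right hN hA hf (h := f i + g i) (fun j p hp hj => by
    simp only [Pi.add_apply, hf i j p hp hj, hg i j p hp hj]
    linear_combination CharTwo.add_self_eq_zero (δ i j)) i
  rw [← add_zero (flagCount N g), ← h1, ← add_zero (flagCount N g), ← h2, flagCount, flagCount,
    ← Finset.sum_add_distrib, ← Finset.sum_add_distrib]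
  refine Finset.sum_congr rfl fun φ _ => ?_
  let T (x : ZMod 2) : ZMod 2 :=
    ∏ j : Fin n, if j = i then x else f j (flagVertex φ j) + f j (flagVertex φ (j + 1))
  have hT (x y : ZMod 2) : T x + T y = T (x + y) :=
    Finset.prod_add_prod_eq (Finset.mem_univ i) (by simp) (fun j _ hj => by simp [hj])
      (fun j _ hj => by simp [hj])
  have hf' : ∏ j : Fin n, (f j (flagVertex φ j) + f j (flagVertex φ (j + 1))) =
      T (f i (flagVertex φ i) + f i (flagVertex φ (i + 1))) := by
    refine Finset.prod_congr rfl fun j _ => ?_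
    split_ifs with h
    · rw [h]
    · rfl
  have hg' : ∏ j : Fin n, (g j (flagVertex φ j) + g j (flagVertex φ (j + 1))) =
      T (g i (flagVertex φ i) + g i (flagVertex φ (i + 1))) := by
    refine Finset.prod_congr rfl fun j _ => ?_
    split_ifs with h
    · rw [h]
    · rw [hfg j h]
  rw [hf', hg']
  refine Eq.trans ?_ (congrArg₂ (· + ·) (hT _ _) rfl).symm
  refine Eq.trans ?_ (hT _ _).symm
  congr 1
  simp only [Pi.add_apply]
  linear_combination - CharTwo.add_self_eq_zero (g i (flagVertex φ i))
    - CharTwo.add_self_eq_zero (g i (flagVertex φ (i + 1)))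

theorem flagCount_eq {n N : ℕ} (hN : 0 < N) (hN' : Even N) {A : Fin n → Finset (Fin n)}
    (hA : ∀ j, j ∈ A j) {δ : Fin n → Fin n → ZMod 2} {f g : Fin n → (Fin n → ℤ) → ZMod 2}
    (hf : BoundaryEquivariant N A δ f) (hg : BoundaryEquivariant N A δ g) :
    flagCount N f = flagCount N g := by
  have key (s : Finset (Fin n)) :
      flagCount N f = flagCount N fun i => if i ∈ s then g i else f i := by
    induction s using Finset.induction_on with
    | empty => simp
    | insert a s _ ih =>
      rw [ih]
      refine flagCount_eq_of_eq_off hN hN' hA (δ := δ) ?_ ?_ a fun j hj => by simp [hj]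
      all_goals
        intro i j p hp hj
        simp only
        split_ifs
        exacts [hg i j p hp hj, hf i j p hp hj]
  simpa using key Finset.univ

theorem flagCount_eq_one {n N : ℕ} {f : Fin n → (Fin n → ℤ) → ZMod 2}
    (e : Fin n → ℤ × ℤ) (he : ∀ j, e j ∈ evenOddEdges N)
    (h : ∀ φ ∈ gridFlags n N,
      (∀ i : Fin n, f i (flagVertex φ i) ≠ f i (flagVertex φ (i + 1))) ↔ φ = (e, 1)) :
    flagCount N f = 1 := by
  have h2 (x y : ZMod 2) : x + y ≠ 0 ↔ x ≠ y := by
    rw [← CharTwo.sub_eq_add, sub_ne_zero]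
  have hmem : (e, (1 : Equiv.Perm (Fin n))) ∈ gridFlags n N := mem_gridFlags.2 he
  rw [flagCount, Finset.sum_eq_single_of_mem _ hmem]
  · refine Finset.prod_eq_one fun i _ => ?_
    have := (h2 _ _).2 ((h _ hmem).2 rfl i)
    generalize f i _ + f i _ = x at this
    revert x
    decide
  · intro φ hφ hne
    by_contra hprod
    exact hne ((h φ hφ).1 fun i => (h2 _ _).1 (Finset.prod_ne_zero_iff.1 hprod i (Finset.mem_univ i)))

/-! ### Two labellings with odd flag count -/

/-- The labels of grid points by their membership in the faces `pᵢ = N`. -/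
def torusLabel {n : ℕ} (N : ℕ) (i : Fin n) (p : Fin n → ℤ) : ZMod 2 := if p i = N then 1 else 0

theorem torusLabel_boundaryEquivariant {n N : ℕ} (hN : 0 < N) :
    BoundaryEquivariant N (fun j : Fin n => {j}) (fun i j => if i = j then 1 else 0)
      (torusLabel N) := by
  intro i j p _ hj
  rcases eq_or_ne i j with rfl | hij
  · have h0 : (N : ℤ) ≠ -N := by omega
    rcases (abs_eq (Int.natCast_nonneg N)).1 hj with h | h
    · simp [torusLabel, negOn, h, h0.symm]
      rfl
    · simp [torusLabel, negOn, h, h0.symm]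
  · simp [torusLabel, negOn, hij]

/-- The `i`-th label sees only coordinate `i`, so step `i` must move coordinate `i`; and it changes
only along an edge ending at `N`, whose even endpoint is `N` and whose odd one is `N - 1`. This
leaves one flag. -/
theorem flagCount_torusLabel {n N : ℕ} (hN : 0 < N) (hN' : Even N) :
    flagCount N (torusLabel (n := n) N) = 1 := by
  obtain ⟨r, hr⟩ := hN'
  refine flagCount_eq_one (fun _ => ((N : ℤ), (N : ℤ) - 1)) (fun j => mem_evenOddEdges.2
    ⟨⟨⟨by simp only; omega, by simp⟩, by simp only; omega, by simp⟩, ⟨r, by simp only; omega⟩,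
      Or.inr rfl⟩) fun φ hφ => ⟨fun h => ?_, ?_⟩
  · have key (i : Fin n) : φ.2 i = i ∧ φ.1 i = ((N : ℤ), (N : ℤ) - 1) := by
      have hi := h i
      have he := mem_evenOddEdges.1 (mem_gridFlags.1 hφ i)
      obtain ⟨he1, ⟨t, ht⟩, he2⟩ := he
      simp only [torusLabel, flagVertex] at hi
      have : φ.2 i = i := by
        by_contra hne
        have hne : (φ.2 i : ℕ) ≠ i := fun h => hne (Fin.ext h)
        have : (φ.2 i : ℕ) < i ↔ (φ.2 i : ℕ) < i + 1 := by omega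
        refine hi ?_
        by_cases h' : (φ.2 i : ℕ) < i + 1
        · simp [h', this.2 h']
        · simp [h', mt this.1 h']
      refine ⟨this, ?_⟩
      simp only [this, lt_self_iff_false, if_false, Nat.lt_succ_self, if_true] at hi
      refine Prod.ext ?_ ?_
      · by_contra hne
        rw [if_neg hne, if_neg (by omega)] at hi
        exact hi rfl
      · by_contra hne
        split_ifs at hi <;> simp at hne hi <;> omega
    exact Prod.ext (funext fun i => (key i).2) (Equiv.ext fun i => (key i).1)
  · rintro rfl i
    simp [torusLabel, flagVertex]

/-- The first nonzero coordinate is positive. -/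
def LexPos {n : ℕ} (p : Fin n → ℤ) : Prop := ∃ j, 0 < p j ∧ ∀ k < j, p k = 0

theorem lexPos_neg_iff {n : ℕ} {p : Fin n → ℤ} (hp : p ≠ 0) : LexPos (-p) ↔ ¬ LexPos p := by
  classical
  obtain ⟨i, hi⟩ := Function.ne_iff.1 hp
  obtain ⟨j, hj, hmin⟩ := WellFounded.has_min (wellFounded_lt (α := Fin n)) {k | p k ≠ 0} ⟨i, hi⟩
  replace hmin : ∀ k < j, p k = 0 := fun k hk => not_not.1 fun h => hmin k h hk
  have huniq (k : Fin n) (hk : p k ≠ 0) (hk' : ∀ l < k, p l = 0) : k = j := by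
    rcases lt_trichotomy k j with h | h | h
    · exact absurd (hmin k h) hk
    · exact h
    · exact absurd (hk' j h) hj
  have h1 : LexPos p ↔ 0 < p j := by
    refine ⟨?_, fun h => ⟨j, h, hmin⟩⟩
    rintro ⟨k, hk, hk'⟩
    rwa [← huniq k hk.ne' hk']
  have h2 : LexPos (-p) ↔ p j < 0 := by
    refine ⟨?_, fun h => ⟨j, by simpa using h, fun k hk => by simp [hmin k hk]⟩⟩
    rintro ⟨k, hk, hk'⟩
    simp only [Pi.neg_apply, neg_eq_zero, Left.neg_pos_iff] at hk hk'
    rwa [← huniq k hk.ne hk']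
  rw [h1, h2, not_lt]
  exact ⟨le_of_lt, fun h => lt_of_le_of_ne h hj⟩

open Classical in
/-- The labels of grid points by the sign of a coordinate, with an odd rule for breaking ties. -/
noncomputable def signLabel {n : ℕ} (i : Fin n) (p : Fin n → ℤ) : ZMod 2 :=
  if 0 < p i ∨ p i = 0 ∧ LexPos p then 1 else 0

theorem signLabel_neg {n : ℕ} (i : Fin n) {p : Fin n → ℤ} (hp : p ≠ 0) :
    signLabel i (-p) = signLabel i p + 1 := by
  have hL := lexPos_neg_iff hp
  have h2 : (0 : ZMod 2) = 1 + 1 := rfl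
  unfold signLabel
  rw [Pi.neg_apply]
  rcases lt_trichotomy (p i) 0 with h | h | h
  · simp [h, h.not_gt, h.ne]
  · by_cases h' : LexPos p
    · have := mt hL.1 (not_not.2 h')
      simp [h, h', this, ← h2]
    · simp [h, h', hL.2 h']
  · simp [h, h.not_gt, h.ne', ← h2]

theorem signLabel_boundaryEquivariant {n N : ℕ} (hN : 0 < N) :
    BoundaryEquivariant N (fun _ : Fin n => Finset.univ) (fun _ _ => 1) signLabel := by
  intro i j p _ hj
  have : negOn Finset.univ p = -p := by
    funext k
    simp [negOn]
  rw [this, signLabel_neg]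
  rintro rfl
  simp at hj
  omega

/-- A sign can change only where the coordinate passes through `0`, so a counted flag starts at the
origin and, by descending induction, moves coordinate `i` at step `i`. The tie rule then dictates
directions: the origin is not `LexPos`, so coordinate `0` moves to `1`; afterwards the vertices are
`LexPos`, so all others move to `-1`. -/
theorem flagCount_signLabel {n N : ℕ} (hN : 0 < N) (hN' : Even N) :
    flagCount N (signLabel (n := n)) = 1 := by
  classical
  have hN2 : 2 ≤ N := by
    obtain ⟨r, hr⟩ := hN'
    omega
  refine flagCount_eq_one (fun j => (0, if (j : ℕ) = 0 then 1 else -1)) (fun j =>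
    mem_evenOddEdges.2 ⟨⟨⟨by simp, by simp⟩, ?_⟩, ⟨0, by simp⟩, ?_⟩) fun φ hφ => ⟨fun h => ?_, ?_⟩
  · simp only
    split_ifs <;> omega
  · simp only
    split_ifs <;> simp
  · have key (d : ℕ) : ∀ i : Fin n, i + d + 1 = n → φ.2 i = i ∧ (φ.1 i).1 = 0 := by
      induction d using Nat.strong_induction_on with
      | _ d ih =>
        intro i hid
        have ih' (j : Fin n) (hj : i < j) : φ.2 j = j :=
          (ih (n - 1 - j) (by rw [Fin.lt_def] at hj; omega) j (by omega)).1
        have hi := h i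
        obtain ⟨he1, ⟨t, ht⟩, he2⟩ := mem_evenOddEdges.1 (mem_gridFlags.1 hφ i)
        have hle : φ.2 i ≤ i := by
          by_contra hlt
          rw [not_le] at hlt
          exact hlt.ne' (φ.2.injective (ih' _ hlt))
        -- Had coordinate `i` moved earlier, it would be odd, hence nonzero and equal at both
        -- vertices, and its label could not change.
        have hstep : φ.2 i = i := by
          by_contra hne
          have hlt : (φ.2 i : ℕ) < i := lt_of_le_of_ne hle fun h => hne (Fin.ext h)
          refine hi ?_
          simp only [signLabel, flagVertex, hlt, hlt.trans (Nat.lt_succ_self _), if_true]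
          have : (φ.1 i).2 ≠ 0 := by omega
          simp [this]
        refine ⟨hstep, ?_⟩
        by_contra h0
        refine hi ?_
        have : (φ.1 i).2 ≠ 0 := by omega
        have h1 : 0 < (φ.1 i).2 ↔ 0 < (φ.1 i).1 := by omega
        simp [signLabel, flagVertex, hstep, h0, this, h1]
    have hρ (i : Fin n) : φ.2 i = i := (key (n - 1 - i) i (by omega)).1
    have ha (i : Fin n) : (φ.1 i).1 = 0 := (key (n - 1 - i) i (by omega)).2
    have hv (i : Fin n) : ¬ (0 < (φ.1 i).2 ↔ LexPos (flagVertex φ i)) := by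
      intro h'
      refine h i ?_
      have hodd : (φ.1 i).2 ≠ 0 := by
        have := mem_evenOddEdges.1 (mem_gridFlags.1 hφ i)
        have := ha i
        omega
      have e1 : flagVertex φ i i = 0 := by simp [flagVertex, hρ, ha]
      have e2 : flagVertex φ (i + 1) i = (φ.1 i).2 := by simp [flagVertex, hρ]
      simp [signLabel, e1, e2, hodd, h']
    have hb0 (i : Fin n) (hi : (i : ℕ) = 0) : (φ.1 i).2 = 1 := by
      have h1 : ¬ LexPos (flagVertex φ i) := by
        rintro ⟨j, hj, -⟩
        simp [flagVertex, hi, ha] at hj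
      have := mem_evenOddEdges.1 (mem_gridFlags.1 hφ i)
      have := ha i
      have := hv i
      simp only [h1, iff_false, not_not] at this
      omega
    have hb (i : Fin n) (hi : (i : ℕ) ≠ 0) : (φ.1 i).2 = -1 := by
      have h1 : LexPos (flagVertex φ i) := by
        refine ⟨⟨0, i.pos⟩, ?_, fun k hk => absurd hk (by simp [Fin.lt_def])⟩
        simp [flagVertex, hρ, hb0, Nat.pos_of_ne_zero hi]
      have := mem_evenOddEdges.1 (mem_gridFlags.1 hφ i)
      have := ha i
      have := hv i
      simp only [h1, iff_true] at this
      omega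
    refine Prod.ext (funext fun i => Prod.ext (ha i) ?_) (Equiv.ext hρ)
    rcases eq_or_ne (i : ℕ) 0 with hi | hi
    · simp [hi, hb0 i hi]
    · simp [hi, hb i hi]
  · rintro rfl i
    rcases eq_or_ne (i : ℕ) 0 with hi | hi
    · have h1 : ¬ LexPos (flagVertex (fun j : Fin n => ((0 : ℤ), if (j : ℕ) = 0 then (1 : ℤ) else -1),
          1) i) := by
        rintro ⟨j, hj, -⟩
        simp [flagVertex, hi] at hj
      simp [signLabel, h1]
      simp [flagVertex, hi]
    · have h1 : LexPos (flagVertex (fun j : Fin n => ((0 : ℤ), if (j : ℕ) = 0 then (1 : ℤ) else -1),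
          1) i) := by
        refine ⟨⟨0, i.pos⟩, ?_, fun k hk => absurd hk (by simp [Fin.lt_def])⟩
        simp [flagVertex, Nat.pos_of_ne_zero hi]
      simp [signLabel, h1]
      simp [flagVertex, hi]

theorem exists_flag_of_boundaryEquivariant {n N : ℕ} (hN : 0 < N) (hN' : Even N)
    {A : Fin n → Finset (Fin n)} (hA : ∀ j, j ∈ A j) {δ : Fin n → Fin n → ZMod 2}
    {f g : Fin n → (Fin n → ℤ) → ZMod 2}
    (hf : BoundaryEquivariant N A δ f) (hg : BoundaryEquivariant N A δ g)
    (hg1 : flagCount N g = 1) :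
    ∃ φ ∈ gridFlags n N, ∀ i : Fin n, f i (flagVertex φ i) ≠ f i (flagVertex φ (i + 1)) := by
  have h1 := (flagCount_eq hN hN' hA hf hg).trans hg1
  obtain ⟨φ, hφ, hne⟩ := Finset.exists_ne_zero_of_sum_ne_zero (h1.symm ▸ one_ne_zero)
  refine ⟨φ, hφ, fun i h => hne (Finset.prod_eq_zero (Finset.mem_univ i) ?_)⟩
  rw [h, CharTwo.add_self_eq_zero]

/-! ### From sign changes on grids to common zeros -/

/-- Continuous functions on the cube `[-1, 1]ⁿ` which, up to a prescribed sign, are invariant under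
certain reflections of the boundary have a common zero, if sign patterns with this symmetry and
odd flag count exist. -/
theorem exists_common_zero_of_flagCount {n : ℕ} (F : Fin n → (Fin n → ℝ) → ℝ)
    (hF : ∀ i, Continuous (F i)) {A : Fin n → Finset (Fin n)} (hA : ∀ j, j ∈ A j)
    {δ : Fin n → Fin n → ZMod 2}
    (hg : ∀ N : ℕ, 0 < N → Even N → ∃ g, BoundaryEquivariant N A δ g ∧ flagCount N g = 1)
    (hFA : ∀ i j (x : Fin n → ℝ), (∀ k, abs (x k) ≤ 1) → abs (x j) = 1 →
      F i (fun k => if k ∈ A j then -x k else x k) = (if δ i j = 1 then -1 else 1) * F i x) :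
    ∃ x, ∀ i, F i x = 0 := by
  have step (N : ℕ) (hN : 0 < N) (hN' : Even N) : ∃ x : Fin n → ℝ, x ∈ Set.Icc (-1) 1 ∧
      ∀ i, ∃ u v, dist u x ≤ (N : ℝ)⁻¹ ∧ dist v x ≤ (N : ℝ)⁻¹ ∧ F i u * F i v ≤ 0 := by
    obtain ⟨g, hg, hg1⟩ := hg N hN hN'
    have hNR : (0 : ℝ) < N := Nat.cast_pos.2 hN
    let s (p : Fin n → ℤ) : Fin n → ℝ := fun k => p k / N
    -- The model labels `g` break ties where `F i` vanishes, so that the boundary symmetry holds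
    -- there too.
    let f (i : Fin n) (p : Fin n → ℤ) : ZMod 2 :=
      if 0 < F i (s p) then 1 else if F i (s p) < 0 then 0 else g i p
    have hs (p : Fin n → ℤ) (k : Fin n) : abs (s p k) = ((|p k| : ℤ) : ℝ) / N := by
      simp only [s]
      rw [abs_div, Nat.abs_cast, Int.cast_abs]
    have hf : BoundaryEquivariant N A δ f := by
      intro i j p hp hj
      have h1 : F i (s (negOn (A j) p)) = (if δ i j = 1 then -1 else 1) * F i (s p) := by
        rw [← hFA i j (s p)]
        · congr 1
          funext k
          simp only [s, negOn]
          split_ifs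
          · push_cast
            ring
          · rfl
        · intro k
          rw [hs, div_le_one hNR]
          exact_mod_cast hp k
        · rw [hs, hj]
          simp [hNR.ne']
      have h2 : δ i j = 0 ∨ δ i j = 1 := by
        generalize δ i j = x
        revert x
        decide
      have h3 : (1 : ZMod 2) + 1 = 0 := rfl
      simp only [f, h1]
      rcases h2 with h2 | h2
      · simp only [h2, zero_ne_one, if_false, one_mul, add_zero, hg i j p hp hj]
      · simp only [h2, if_true, neg_mul, one_mul, Left.neg_pos_iff, Left.neg_neg_iff,
          hg i j p hp hj]
        rcases lt_trichotomy (F i (s p)) 0 with h | h | h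
        · simp [h, h.not_gt]
        · simp [h]
        · simp [h, h.not_gt, h3]
    obtain ⟨φ, hφ, hne⟩ := exists_flag_of_boundaryEquivariant hN hN' hA hf hg hg1
    have hd (k : ℕ) : dist (s (flagVertex φ k)) (s (flagVertex φ 0)) ≤ (N : ℝ)⁻¹ := by
      rw [dist_pi_le_iff (by positivity)]
      intro j
      have h1 := (mem_evenOddEdges.1 (mem_gridFlags.1 hφ j)).2.2
      have h2 : |flagVertex φ k j - flagVertex φ 0 j| ≤ 1 := by
        rw [abs_le]
        simp only [flagVertex, Nat.not_lt_zero, if_false]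
        split_ifs <;> omega
      simp only [s]
      rw [Real.dist_eq, ← sub_div, abs_div, Nat.abs_cast, ← Int.cast_sub, ← Int.cast_abs,
        div_eq_mul_inv]
      exact mul_le_of_le_one_left (by positivity) (by exact_mod_cast h2)
    refine ⟨s (flagVertex φ 0), ?_, fun i => ⟨_, _, hd i, hd (i + 1), ?_⟩⟩
    · have h (k) : abs (s (flagVertex φ 0) k) ≤ 1 := by
        rw [hs, div_le_one hNR]
        exact_mod_cast abs_flagVertex_le hφ 0 k
      exact ⟨fun k => (abs_le.1 (h k)).1, fun k => (abs_le.1 (h k)).2⟩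
    · have := hne i
      by_contra hpos
      refine this ?_
      rw [not_le, mul_pos_iff] at hpos
      rcases hpos with ⟨h1, h2⟩ | ⟨h1, h2⟩
      · simp [f, h1, h2]
      · simp [f, h1, h2, h1.not_gt, h2.not_gt]
  -- Even grids of growing size; an accumulation point of their flags is the common zero.
  choose x hx huv using fun m : ℕ => step (2 * (m + 1)) (by omega) (even_two_mul _)
  choose u v hu hv huv using huv
  obtain ⟨a, -, φ, hφ, ha⟩ := (isCompact_Icc (a := (-1 : Fin n → ℝ)) (b := 1)).tendsto_subseq hx
  have h0 : Filter.Tendsto (fun m => (((2 * (φ m + 1) : ℕ) : ℝ))⁻¹) Filter.atTop (nhds 0) := by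
    refine tendsto_inv_atTop_zero.comp (tendsto_natCast_atTop_atTop.comp ?_)
    refine Filter.tendsto_atTop_mono (fun m => ?_) hφ.tendsto_atTop
    omega
  have hlim (w : ℕ → Fin n → ℝ) (hw : ∀ m, dist (w m) (x m) ≤ (((2 * (m + 1) : ℕ) : ℝ))⁻¹) :
      Filter.Tendsto (fun m => w (φ m)) Filter.atTop (nhds a) := by
    refine ha.congr_dist (squeeze_zero (fun _ => dist_nonneg) (fun m => ?_) h0)
    rw [dist_comm]
    exact hw _
  refine ⟨a, fun i => ?_⟩
  have h1 := ((hF i).tendsto a).comp (hlim (fun m => u m i) fun m => hu m i)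
  have h2 := ((hF i).tendsto a).comp (hlim (fun m => v m i) fun m => hv m i)
  have := le_of_tendsto (h1.mul h2) (Filter.Eventually.of_forall fun m => huv (φ m) i)
  exact mul_self_eq_zero.1 (le_antisymm this (mul_self_nonneg _))

/-- Continuous functions on the cube which are odd on its boundary have a common zero. -/
theorem exists_common_zero_of_odd_on_boundary {n : ℕ} (F : Fin n → (Fin n → ℝ) → ℝ)
    (hF : ∀ i, Continuous (F i)) (hodd : ∀ i x, ‖x‖ = 1 → F i (-x) = -F i x) :
    ∃ x, ∀ i, F i x = 0 := by
  refine exists_common_zero_of_flagCount F hF (A := fun _ => Finset.univ) (δ := fun _ _ => 1)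
    (by simp) (fun N hN hN' => ⟨_, signLabel_boundaryEquivariant hN, flagCount_signLabel hN hN'⟩) ?_
  intro i j x hx hj
  have : ‖x‖ = 1 := le_antisymm ((pi_norm_le_iff_of_nonneg zero_le_one).2 hx)
    (hj ▸ norm_le_pi_norm x j)
  simpa [← Pi.neg_def] using hodd i x this

/-- Continuous functions on the cube such that the `i`-th one takes opposite values at the ends of
the segments which are parallel to the `i`-th axis, and equal values at the ends of the segments
which are parallel to another axis, have a common zero. -/
theorem exists_common_zero_of_antiperiodic {n : ℕ} (F : Fin n → (Fin n → ℝ) → ℝ)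
    (hF : ∀ i, Continuous (F i))
    (hper : ∀ i j x, abs (x j) = 1 →
      F i (Function.update x j (-x j)) = (if i = j then -1 else 1) * F i x) :
    ∃ x, ∀ i, F i x = 0 := by
  refine exists_common_zero_of_flagCount F hF (A := fun j => {j})
    (δ := fun i j => if i = j then 1 else 0) (by simp)
    (fun N hN hN' => ⟨_, torusLabel_boundaryEquivariant hN, flagCount_torusLabel hN hN'⟩) ?_
  intro i j x _ hj
  have h1 : (fun k => if k ∈ ({j} : Finset (Fin n)) then -x k else x k) =
      Function.update x j (-x j) := by
    funext k
    rcases eq_or_ne k j with rfl | h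
    · simp
    · simp [h]
  rw [h1, hper i j x hj]
  split_ifs <;> simp_all

/-! ### Choosing signs that violate many constraints -/

open Classical in
/-- If each constraint relates the signs of two different vertices and is violated when one of the
two is changed, then signs can be chosen which satisfy at most half of the constraints. -/
theorem exists_signs_two_mul_card_filter_le {ι V : Type*} (T : Finset ι) (a b : ι → V)
    (R : ι → ℤˣ → ℤˣ → Prop) (hab : ∀ y ∈ T, a y ≠ b y)
    (hl : ∀ y s t, R y s t → ¬ R y (-s) t) (hr : ∀ y s t, R y s t → ¬ R y s (-t)) :
    ∃ ω : V → ℤˣ, 2 * (T.filter fun y => R y (ω (a y)) (ω (b y))).card ≤ T.card := by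
  induction h : T.card using Nat.strong_induction_on generalizing T with
  | _ c ih =>
    subst h
    obtain rfl | ⟨y₀, hy₀⟩ := T.eq_empty_or_nonempty
    · exact ⟨1, by simp⟩
    let v := a y₀
    -- Constraints not involving `v` are settled by induction; those in `S` have exactly one end at
    -- `v`, so no constraint of `S` is satisfied by both signs of `v`, and one sign satisfies at
    -- most half of them.
    let S := T.filter fun y => a y = v ∨ b y = v
    obtain ⟨ω, hω⟩ := ih (T \ S).card
      (Finset.card_lt_card (Finset.sdiff_ssubset (Finset.filter_subset _ _)
        ⟨y₀, Finset.mem_filter.2 ⟨hy₀, Or.inl rfl⟩⟩)) (T \ S)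
      (fun y hy => hab y (Finset.mem_sdiff.1 hy).1) rfl
    let P (ω : V → ℤˣ) (y : ι) : Prop := R y (ω (a y)) (ω (b y))
    let ω' (s : ℤˣ) : V → ℤˣ := Function.update ω v s
    have hdisj : Disjoint (S.filter (P (ω' 1))) (S.filter (P (ω' (-1)))) := by
      rw [Finset.disjoint_filter]
      intro y hy h1 h2
      obtain ⟨hyT, hy⟩ := Finset.mem_filter.1 hy
      have hne := hab y hyT
      simp only [P, ω'] at h1 h2
      rcases hy with hy | hy
      · rw [hy] at hne
        rw [hy, Function.update_self, Function.update_of_ne hne.symm] at h1 h2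
        exact hl y _ _ h1 h2
      · rw [hy] at hne
        rw [hy, Function.update_self, Function.update_of_ne hne] at h1 h2
        exact hr y _ _ h1 h2
    have hcard : (S.filter (P (ω' 1))).card + (S.filter (P (ω' (-1)))).card ≤ S.card := by
      rw [← Finset.card_union_of_disjoint hdisj]
      exact Finset.card_le_card (Finset.union_subset (Finset.filter_subset _ _)
        (Finset.filter_subset _ _))
    obtain ⟨s, hs⟩ : ∃ s, 2 * (S.filter (P (ω' s))).card ≤ S.card := by
      by_contra! hcon
      have := hcon 1
      have := hcon (-1)
      omega
    have hrest : (T \ S).filter (P (ω' s)) = (T \ S).filter (P ω) := by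
      refine Finset.filter_congr fun y hy => ?_
      obtain ⟨hyT, hyS⟩ := Finset.mem_sdiff.1 hy
      have : ¬ (a y = v ∨ b y = v) := fun h => hyS (Finset.mem_filter.2 ⟨hyT, h⟩)
      rw [not_or] at this
      simp only [P, ω', Function.update_of_ne this.1, Function.update_of_ne this.2]
    refine ⟨ω' s, ?_⟩
    have hsplit : (T.filter (P (ω' s))).card =
        (S.filter (P (ω' s))).card + ((T \ S).filter (P (ω' s))).card := by
      rw [← Finset.card_union_of_disjoint, ← Finset.filter_union,
        Finset.union_sdiff_of_subset (Finset.filter_subset _ _)]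
      exact Finset.disjoint_filter_filter Finset.disjoint_sdiff
    have hST : S.card + (T \ S).card = T.card := by
      rw [add_comm, Finset.card_sdiff_add_card_eq_card (Finset.filter_subset _ _)]
    rw [hrest] at hsplit
    change 2 * (T.filter (P (ω' s))).card ≤ T.card
    change 2 * ((T \ S).filter (P ω)).card ≤ (T \ S).card at hω
    omega

/-- Suppose that every choice of `n` sign functions satisfies the `n` constraints of one of the
elements of `T`. Then `T` has at least `2 ^ n` elements. -/
theorem two_pow_le_card_of_forall_signs {ι V : Type*} {n : ℕ} (T : Finset ι) (a b : Fin n → ι → V)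
    (R : Fin n → ι → ℤˣ → ℤˣ → Prop) (hab : ∀ i, ∀ y ∈ T, a i y ≠ b i y)
    (hl : ∀ i y s t, R i y s t → ¬ R i y (-s) t) (hr : ∀ i y s t, R i y s t → ¬ R i y s (-t))
    (h : ∀ ω : Fin n → V → ℤˣ, ∃ y ∈ T, ∀ i, R i y (ω i (a i y)) (ω i (b i y))) :
    2 ^ n ≤ T.card := by
  classical
  induction n generalizing T with
  | zero =>
    obtain ⟨y, hy, -⟩ := h Fin.elim0
    exact Finset.card_pos.2 ⟨y, hy⟩
  | succ n ih =>
    -- The first sign function is fixed so as to keep at most half of `T`; the survivors satisfy the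
    -- hypothesis for the other `n` sign functions.
    obtain ⟨ω₀, hω₀⟩ := exists_signs_two_mul_card_filter_le T (a 0) (b 0) (R 0) (hab 0) (hl 0)
      (hr 0)
    have := ih (T.filter fun y => R 0 y (ω₀ (a 0 y)) (ω₀ (b 0 y))) (fun i => a i.succ)
      (fun i => b i.succ) (fun i => R i.succ) (fun i y hy => hab _ y (Finset.mem_filter.1 hy).1)
      (fun i => hl _) (fun i => hr _) (fun ω => by
        obtain ⟨y, hy, hy'⟩ := h (Fin.cons ω₀ ω)
        exact ⟨y, Finset.mem_filter.2 ⟨hy, hy' 0⟩, fun i => hy' i.succ⟩)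
    rw [pow_succ]
    omega

section LineFields

open scoped RealInnerProductSpace

/-! ### Continuous fields of lines -/

section LineField

variable {Z W : Type*} [TopologicalSpace Z] [NormedAddCommGroup W] [InnerProductSpace ℝ W]

/-- A continuous field of lines in an inner product space, given by the orthogonal projections. -/
structure IsLineField (P : Z → W →L[ℝ] W) : Prop where
  continuous : Continuous P
  exists_unit : ∀ z, ∃ u : W, ‖u‖ = 1 ∧ ∀ w, P z w = ⟪u, w⟫ • u

/-- A continuous choice of unit vectors in the lines of a field. -/
structure IsUnitSection (P : Z → W →L[ℝ] W) (ℓ : Z → W) : Prop where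
  continuous : Continuous ℓ
  norm_eq_one : ∀ z, ‖ℓ z‖ = 1
  apply_self : ∀ z, P z (ℓ z) = ℓ z

namespace IsLineField

variable {P : Z → W →L[ℝ] W}

/-- A unit vector fixed by the projection spans its image, so any such vector can replace the given
`u`. -/
theorem apply_eq (hP : IsLineField P) {z : Z} {b : W} (hb : ‖b‖ = 1) (hPb : P z b = b) (w : W) :
    P z w = ⟪b, w⟫ • b := by
  obtain ⟨u, hu, h⟩ := hP.exists_unit z
  rw [h] at hPb
  have h1 : ⟪u, b⟫ * ⟪u, b⟫ = 1 := by
    have := congrArg (fun v => ⟪b, v⟫) hPb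
    simp only [real_inner_smul_right, real_inner_self_eq_norm_sq, hb] at this
    rwa [real_inner_comm u b, one_pow] at this
  rw [h, ← hPb, real_inner_smul_left, smul_smul, mul_right_comm, h1, one_mul]

theorem exists_unit_vector (hP : IsLineField P) (z : Z) : ∃ b : W, ‖b‖ = 1 ∧ P z b = b := by
  obtain ⟨u, hu, h⟩ := hP.exists_unit z
  exact ⟨u, hu, by rw [h, real_inner_self_eq_norm_sq, hu]; simp⟩

theorem apply_apply (hP : IsLineField P) (z : Z) (w : W) : P z (P z w) = P z w := by
  obtain ⟨b, -, hPb⟩ := hP.exists_unit_vector z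
  obtain ⟨u, hu, h⟩ := hP.exists_unit z
  simp [h, real_inner_smul_right, hu]

theorem comp {Y : Type*} [TopologicalSpace Y] (hP : IsLineField P) {f : Y → Z} (hf : Continuous f) :
    IsLineField (P ∘ f) :=
  ⟨hP.continuous.comp hf, fun _ => hP.exists_unit _⟩

theorem inner_eq_one_or_neg_one (hP : IsLineField P) {z : Z} {b c : W} (hb : ‖b‖ = 1)
    (hPb : P z b = b) (hc : ‖c‖ = 1) (hPc : P z c = c) : ⟪b, c⟫ = 1 ∨ ⟪b, c⟫ = -1 := by
  have h := hP.apply_eq hb hPb c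
  rw [hPc] at h
  have := congrArg norm h
  rw [norm_smul, hb, hc, mul_one, Real.norm_eq_abs, eq_comm, abs_eq zero_le_one] at this
  exact this

/-- Unit sections are unique up to sign. -/
theorem unitSection_eq_or_eq_neg [PreconnectedSpace Z] (hP : IsLineField P) {ℓ ℓ' : Z → W}
    (h : IsUnitSection P ℓ) (h' : IsUnitSection P ℓ') :
    ∃ σ : ℝ, σ * σ = 1 ∧ ∀ z, ℓ' z = σ • ℓ z := by
  have h1 (z : Z) : ℓ' z = ⟪ℓ z, ℓ' z⟫ • ℓ z := by
    rw [← hP.apply_eq (h.norm_eq_one z) (h.apply_self z), h'.apply_self]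
  have hc : Continuous fun z => ⟪ℓ z, ℓ' z⟫ := h.continuous.inner h'.continuous
  rcases isPreconnected_univ.eq_one_or_eq_neg_one_of_sq_eq hc.continuousOn (fun z _ => by
    rcases hP.inner_eq_one_or_neg_one (h.norm_eq_one z) (h.apply_self z) (h'.norm_eq_one z)
      (h'.apply_self z) with h | h <;> simp [h]) with h2 | h2
  · exact ⟨1, one_mul _, fun z => (h1 z).trans (congrArg (· • ℓ z) (h2 (Set.mem_univ z)))⟩
  · exact ⟨-1, by norm_num, fun z => (h1 z).trans (congrArg (· • ℓ z) (h2 (Set.mem_univ z)))⟩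

end IsLineField

theorem IsUnitSection.comp {P : Z → W →L[ℝ] W} {ℓ : Z → W} (h : IsUnitSection P ℓ) {Y : Type*}
    [TopologicalSpace Y] {f : Y → Z} (hf : Continuous f) : IsUnitSection (P ∘ f) (ℓ ∘ f) :=
  ⟨h.continuous.comp hf, fun _ => h.norm_eq_one _, fun _ => h.apply_self _⟩

/-- A field of lines over a compact contractible space has a unit section. -/
theorem IsLineField.exists_unitSection {X : Type*} [PseudoMetricSpace X] [CompactSpace X]
    [ContractibleSpace X] {P : X → W →L[ℝ] W} (hP : IsLineField P) :
    ∃ ℓ, IsUnitSection P ℓ := by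
  obtain ⟨x₀, ⟨H⟩⟩ := id_nullhomotopic X
  have hQ : IsLineField (P ∘ H) := hP.comp H.continuous
  obtain ⟨ε, hε, hunif⟩ := Metric.uniformContinuous_iff.1
    (CompactSpace.uniformContinuous_of_continuous hQ.continuous) 1 one_pos
  obtain ⟨N, hN⟩ := exists_nat_gt ε⁻¹
  have hN0 : (0 : ℝ) < N := (inv_pos.2 hε).trans hN
  -- The time runs backwards along the contraction `H`, from the constant map at `1` to the identity
  -- at `0`.
  let s (j : ℕ) : unitInterval := Set.projIcc 0 1 zero_le_one (1 - (j : ℝ) / N)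
  have key (j : ℕ) : ∃ ℓ : X → W, IsUnitSection (fun x => P (H (s j, x))) ℓ := by
    induction j with
    | zero =>
      obtain ⟨b, hb, hPb⟩ := hP.exists_unit_vector x₀
      have h0 (x : X) : H (s 0, x) = x₀ := by
        have : s 0 = 1 := by simp [s]
        rw [this, H.apply_one]
        rfl
      exact ⟨fun _ => b, continuous_const, fun _ => hb, fun x => by rw [h0, hPb]⟩
    | succ j ih =>
      obtain ⟨ℓ, hℓ⟩ := ih
      -- The steps are so short that projecting to the next line moves a unit vector by less than
      -- `1`; the result is nonzero and can be normalized.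
      have hlt (x : X) : ‖P (H (s (j + 1), x)) (ℓ x) - ℓ x‖ < 1 := by
        have hd : dist (s (j + 1), x) (s j, x) < ε := by
          rw [Prod.dist_eq, dist_self, max_eq_left dist_nonneg, Subtype.dist_eq, Real.dist_eq]
          refine (Set.abs_projIcc_sub_projIcc (zero_le_one (α := ℝ))).trans_lt ?_
          have : 1 - ((j + 1 : ℕ) : ℝ) / N - (1 - (j : ℝ) / N) = -(N : ℝ)⁻¹ := by
            push_cast
            field_simp
            ring
          rw [this, abs_neg, abs_of_pos (inv_pos.2 hN0)]
          exact inv_lt_of_inv_lt₀ hε hN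
        have := hunif hd
        rw [dist_eq_norm] at this
        calc ‖P (H (s (j + 1), x)) (ℓ x) - ℓ x‖
            = ‖(P (H (s (j + 1), x)) - P (H (s j, x))) (ℓ x)‖ := by
              rw [sub_apply, hℓ.apply_self]
          _ ≤ ‖P (H (s (j + 1), x)) - P (H (s j, x))‖ * ‖ℓ x‖ := ContinuousLinearMap.le_opNorm _ _
          _ < 1 := by rw [hℓ.norm_eq_one, mul_one]; exact this
      have hne (x : X) : ‖P (H (s (j + 1), x)) (ℓ x)‖ ≠ 0 := by
        intro h
        have := hlt x
        rw [norm_eq_zero.1 h, zero_sub, norm_neg, hℓ.norm_eq_one] at this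
        exact lt_irrefl _ this
      have hcont : Continuous fun x => P (H (s (j + 1), x)) (ℓ x) :=
        (hP.continuous.comp (H.continuous.comp (by fun_prop))).clm_apply hℓ.continuous
      refine ⟨fun x => ‖P (H (s (j + 1), x)) (ℓ x)‖⁻¹ • P (H (s (j + 1), x)) (ℓ x),
        (hcont.norm.inv₀ hne).smul hcont, fun x => ?_, fun x => ?_⟩
      · rw [norm_smul, norm_inv, norm_norm, inv_mul_cancel₀ (hne x)]
      · simp only [map_smul, hP.apply_apply]
  obtain ⟨ℓ, hℓ⟩ := key N
  have h1 : s N = 0 := by simp [s, hN0.ne']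
  simp only [h1, H.apply_zero, ContinuousMap.id_apply] at hℓ
  exact ⟨ℓ, hℓ⟩

end LineField

instance stdSimplex.contractibleSpace (m : ℕ) : ContractibleSpace (stdSimplex ℝ (Fin (m + 1))) :=
  (convex_stdSimplex ℝ _).contractibleSpace ⟨_, single_mem_stdSimplex ℝ 0⟩

instance stdSimplex.compactSpace' (m : ℕ) : CompactSpace (stdSimplex ℝ (Fin (m + 1))) :=
  isCompact_iff_compactSpace.1 (isCompact_stdSimplex ℝ _)

/-! ### Distributing the mass of a point of a simplex over consecutive blocks -/

theorem stdSimplex.map_apply_eq_sum {m m' : ℕ} (θ : Fin (m' + 1) → Fin (m + 1))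
    (t : stdSimplex ℝ (Fin (m' + 1))) (k : Fin (m + 1)) :
    stdSimplex.map θ t k = ∑ j with θ j = k, t j := by
  rw [stdSimplex.map_coe, FunOnFinite.linearMap_apply_apply]

/-- The length of the intersection of the interval `[lo, hi]` with the `k`-th of the consecutive
intervals into which the barycentric coordinates divide `[0, 1]`. -/
noncomputable def blockWeight (lo hi : ℝ) {m : ℕ} (t : stdSimplex ℝ (Fin (m + 1)))
    (k : Fin (m + 1)) : ℝ :=
  max lo (min (∑ j ∈ Finset.Iic k, t j) hi) - max lo (min (∑ j ∈ Finset.Iio k, t j) hi)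

theorem blockWeight_nonneg (lo hi : ℝ) {m : ℕ} (t : stdSimplex ℝ (Fin (m + 1)))
    (k : Fin (m + 1)) : 0 ≤ blockWeight lo hi t k := by
  have : ∑ j ∈ Finset.Iio k, t j ≤ ∑ j ∈ Finset.Iic k, t j :=
    Finset.sum_le_sum_of_subset_of_nonneg Finset.Iio_subset_Iic_self fun j _ _ => t.2.1 j
  exact sub_nonneg.2 (max_le_max_left _ (min_le_min_right _ this))

theorem continuous_blockWeight (lo hi : ℝ) {m : ℕ} (k : Fin (m + 1)) :
    Continuous fun t : stdSimplex ℝ (Fin (m + 1)) => blockWeight lo hi t k := by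
  have (s : Finset (Fin (m + 1))) :
      Continuous fun t : stdSimplex ℝ (Fin (m + 1)) => ∑ j ∈ s, t j :=
    continuous_finsetSum _ fun j _ => (continuous_apply j).comp continuous_subtype_val
  exact (continuous_const.max ((this _).min continuous_const)).sub
    (continuous_const.max ((this _).min continuous_const))

/-- The sum telescopes along an initial segment. -/
theorem sum_blockWeight_of_isLowerSet (lo hi : ℝ) {m : ℕ} (t : stdSimplex ℝ (Fin (m + 1)))
    (s : Finset (Fin (m + 1))) (hs : IsLowerSet (s : Set (Fin (m + 1)))) :
    ∑ k ∈ s, blockWeight lo hi t k = max lo (min (∑ j ∈ s, t j) hi) - max lo (min 0 hi) := by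
  induction s using Finset.induction_on_max with
  | empty => simp
  | insert a s ha ih =>
    have has : a ∉ s := fun h => lt_irrefl _ (ha a h)
    have h1 : s = Finset.Iio a := by
      ext x
      refine ⟨fun h => Finset.mem_Iio.2 (ha x h), fun h => ?_⟩
      have : x ∈ insert a s := hs (Finset.mem_Iio.1 h).le (Finset.mem_insert_self a s)
      exact (Finset.mem_insert.1 this).resolve_left (Finset.mem_Iio.1 h).ne
    have h2 : insert a s = Finset.Iic a := by
      rw [h1, Finset.Iio_insert]
    rw [Finset.sum_insert has, ih, h2, h1, blockWeight]
    · ring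
    · rw [h1, Finset.coe_Iio]
      exact isLowerSet_Iio a

theorem sum_blockWeight {lo hi : ℝ} (h0 : 0 ≤ lo) (h : lo ≤ hi) (h1 : hi ≤ 1) {m : ℕ}
    (t : stdSimplex ℝ (Fin (m + 1))) : ∑ k, blockWeight lo hi t k = hi - lo := by
  rw [sum_blockWeight_of_isLowerSet lo hi t Finset.univ (by simpa using isLowerSet_univ),
    stdSimplex.sum_eq_one, min_eq_right h1, max_eq_right h, min_eq_left (h0.trans h),
    max_eq_left h0]

/-- For monotone `θ`, the fibre over `k` is the difference of two initial segments, whose telescoped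
sums have the same ends as the interval of `k`. This naturality lets sections defined by block
weights glue along faces and degeneracies. -/
theorem blockWeight_map (lo hi : ℝ) {m m' : ℕ} (θ : Fin (m' + 1) →o Fin (m + 1))
    (t : stdSimplex ℝ (Fin (m' + 1))) (k : Fin (m + 1)) :
    blockWeight lo hi (stdSimplex.map θ t) k = ∑ j with θ j = k, blockWeight lo hi t j := by
  classical
  have key (s : Finset (Fin (m + 1))) :
      ∑ i ∈ s, stdSimplex.map θ t i = ∑ j with θ j ∈ s, t j := by
    simp only [stdSimplex.map_apply_eq_sum]
    rw [← Finset.sum_fiberwise_of_maps_to (s := Finset.univ.filter fun j => θ j ∈ s) (t := s)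
      (g := θ) (by simp)]
    refine Finset.sum_congr rfl fun i hi => Finset.sum_congr ?_ fun _ _ => rfl
    ext j
    simp only [Finset.mem_filter, Finset.mem_univ, true_and]
    exact ⟨fun h => ⟨h ▸ hi, h⟩, fun h => h.2⟩
  have hlow (s : Finset (Fin (m + 1))) (hs : IsLowerSet (s : Set (Fin (m + 1)))) :
      IsLowerSet ((Finset.univ.filter fun j => θ j ∈ s : Finset _) : Set (Fin (m' + 1))) := by
    intro a b hab ha
    simp only [Finset.coe_filter, Finset.mem_univ, true_and, Set.mem_ofPred_eq] at ha ⊢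
    exact hs (θ.monotone hab) ha
  have h1 := sum_blockWeight_of_isLowerSet lo hi t _ (hlow (Finset.Iic k)
    (by simpa using isLowerSet_Iic k))
  have h2 := sum_blockWeight_of_isLowerSet lo hi t _ (hlow (Finset.Iio k)
    (by simpa using isLowerSet_Iio k))
  have h3 : (Finset.univ.filter fun j => θ j ∈ Finset.Iic k) =
      (Finset.univ.filter fun j => θ j ∈ Finset.Iio k) ∪ (Finset.univ.filter fun j => θ j = k) := by
    ext j
    simp [le_iff_lt_or_eq]
  have h4 : Disjoint (Finset.univ.filter fun j => θ j ∈ Finset.Iio k)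
      (Finset.univ.filter fun j => θ j = k) := by
    rw [Finset.disjoint_filter]
    intro j _ h h'
    simp [h'] at h
  rw [blockWeight, key, key]
  have h5 := Finset.sum_union h4 (f := fun j => blockWeight lo hi t j)
  rw [← h3] at h5
  linarith

theorem lt_of_blockWeight_pos {lo hi : ℝ} {m : ℕ} {t : stdSimplex ℝ (Fin (m + 1))}
    {k : Fin (m + 1)} (h : 0 < blockWeight lo hi t k) :
    lo < ∑ j ∈ Finset.Iic k, t j ∧ ∑ j ∈ Finset.Iio k, t j < hi := by
  constructor
  · by_contra! hle
    rw [blockWeight, max_eq_left ((min_le_left _ _).trans hle)] at h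
    linarith [le_max_left lo (min (∑ j ∈ Finset.Iio k, t j) hi)]
  · by_contra! hle
    rw [blockWeight, min_eq_right hle] at h
    linarith [max_le_max_left lo (min_le_right (∑ j ∈ Finset.Iic k, t j) hi)]

theorem le_of_blockWeight_pos {lo hi lo' hi' : ℝ} (hlo : hi ≤ lo') {m : ℕ}
    {t : stdSimplex ℝ (Fin (m + 1))} {k k' : Fin (m + 1)} (h : 0 < blockWeight lo hi t k)
    (h' : 0 < blockWeight lo' hi' t k') : k ≤ k' := by
  by_contra! hlt
  have h1 : ∑ j ∈ Finset.Iic k', t j ≤ ∑ j ∈ Finset.Iio k, t j :=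
    Finset.sum_le_sum_of_subset_of_nonneg
      (fun j hj => Finset.mem_Iio.2 ((Finset.mem_Iic.1 hj).trans_lt hlt)) fun j _ _ => t.2.1 j
  have := (lt_of_blockWeight_pos h).2
  have := (lt_of_blockWeight_pos h').1
  linarith

/-- If each of `n` consecutive blocks contains points where the label of this block avoids a given
value, then there are `n + 1` points such that the `i`-th label differs at the `i`-th and the next
of them. -/
theorem exists_strictMono_alternating {n m : ℕ} {α : Type*} (ε : Fin n → Fin (m + 1) → α)
    (B : Fin n → Fin (m + 1) → Prop) (hB : ∀ i j k k', i < j → B i k → B j k' → k ≤ k')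
    (h : ∀ i s, ∃ k, B i k ∧ ε i k ≠ s) :
    ∃ w : Fin (n + 1) → Fin (m + 1), StrictMono w ∧ ∀ i : Fin n, ε i (w i.castSucc) ≠ ε i (w i.succ) := by
  choose k hk hk' using h
  -- Greedy choice: `w (i + 1)` is a point of block `i` whose `i`-th label differs from the one at
  -- `w i`. The order of the blocks gives `w i ≤ w (i + 1)`, and the differing label makes it
  -- strict.
  let w : ℕ → Fin (m + 1) := fun j => Nat.rec 0
    (fun i v => if hi : i < n then k ⟨i, hi⟩ (ε ⟨i, hi⟩ v) else v) j
  have hw (i : Fin n) : w (i + 1) = k i (ε i (w i)) := by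
    change (if hi : (i : ℕ) < n then k ⟨i, hi⟩ (ε ⟨i, hi⟩ (w i)) else w i) = _
    rw [dif_pos i.2]
  have halt (i : Fin n) : ε i (w i) ≠ ε i (w (i + 1)) := by
    rw [hw]
    exact (hk' i _).symm
  refine ⟨fun i => w i, Fin.strictMono_iff_lt_succ.2 fun i => ?_, halt⟩
  refine lt_of_le_of_ne ?_ fun h => halt i (congrArg (ε i) h)
  rcases Nat.eq_zero_or_pos (i : ℕ) with h0 | h0
  · simp only [Fin.val_castSucc, h0]
    exact Fin.zero_le _
  · let j : Fin n := ⟨i - 1, by omega⟩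
    have hj : (j : ℕ) + 1 = i := by simp only [j]; omega
    have h1 : B j (w i) := by
      rw [← hj, hw]
      exact hk _ _
    have h2 : B i (w (i + 1)) := by
      rw [hw]
      exact hk _ _
    exact hB j i _ _ (by rw [Fin.lt_def]; omega) h1 h2

section SimplexAtlasSections

/-! ### Sections of line fields over spaces glued from simplices -/

/-- A presentation of a space as a quotient of simplices along monotone simplicial maps: the
simplices cover the space, and compatible continuous maps on the simplices glue. -/
structure SimplexAtlas (Z : Type*) [TopologicalSpace Z] where
  /-- The simplices. -/
  Index : Type w
  /-- The dimension of a simplex. -/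
  dim : Index → ℕ
  /-- The characteristic map of a simplex. -/
  chart : ∀ x, C(stdSimplex ℝ (Fin (dim x + 1)), Z)
  surj : ∀ z, ∃ x t, chart x t = z
  glue : ∀ {W : Type} [TopologicalSpace W] (s : ∀ x, C(stdSimplex ℝ (Fin (dim x + 1)), W)),
    (∀ x x' (θ : Fin (dim x' + 1) →o Fin (dim x + 1)),
      (∀ t, chart x' t = chart x (stdSimplex.map θ t)) → ∀ t, s x' t = s x (stdSimplex.map θ t)) →
    ∃ S : Z → W, Continuous S ∧ ∀ x t, S (chart x t) = s x t

/-- Sections of the line fields `P i` have a common zero. -/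
def HasCommonZeros {Z : Type*} [TopologicalSpace Z] {W : Type*} [NormedAddCommGroup W]
    [InnerProductSpace ℝ W] {n : ℕ} (P : Fin n → Z → W →L[ℝ] W) : Prop :=
  ∀ S : Fin n → Z → W, (∀ i, Continuous (S i)) → (∀ i z, P i z (S i z) = S i z) →
    ∃ z, ∀ i, S i z = 0

variable {Z : Type*} [TopologicalSpace Z] {W : Type} [NormedAddCommGroup W]
  [InnerProductSpace ℝ W]

/-- The section of a line field which, on a simplex, averages the signs of the vertices in a block
with respect to a unit section. -/
theorem SimplexAtlas.exists_blockSection (𝒜 : SimplexAtlas Z) {P : Z → W →L[ℝ] W}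
    (hP : IsLineField P) (b : Z → W) (lo hi : ℝ) :
    ∃ S : Z → W, Continuous S ∧ (∀ z, P z (S z) = S z) ∧ ∀ x ℓ, IsUnitSection (P ∘ 𝒜.chart x) ℓ →
      ∀ t, S (𝒜.chart x t) = (∑ k, blockWeight lo hi t k *
        ⟪ℓ (stdSimplex.vertex k), b (𝒜.chart x (stdSimplex.vertex k))⟫) • ℓ t := by
  choose ℓ hℓ using fun x => (hP.comp (𝒜.chart x).continuous).exists_unitSection
  let s (x) (ℓ : stdSimplex ℝ (Fin (𝒜.dim x + 1)) → W) (t : stdSimplex ℝ (Fin (𝒜.dim x + 1))) : W :=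
    (∑ k, blockWeight lo hi t k *
      ⟪ℓ (stdSimplex.vertex k), b (𝒜.chart x (stdSimplex.vertex k))⟫) • ℓ t
  -- A change of sign of `ℓ` occurs twice, in the inner products and in the last factor, so the
  -- section does not depend on the trivialization.
  have hs (x) (ℓ ℓ') (h : IsUnitSection (P ∘ 𝒜.chart x) ℓ) (h' : IsUnitSection (P ∘ 𝒜.chart x) ℓ') :
      s x ℓ' = s x ℓ := by
    obtain ⟨c, hc, hℓ⟩ := (hP.comp (𝒜.chart x).continuous).unitSection_eq_or_eq_neg h h'
    funext t
    simp only [s, hℓ, real_inner_smul_left, smul_smul, Finset.sum_mul]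
    congr 1
    refine Finset.sum_congr rfl fun k _ => ?_
    linear_combination (blockWeight lo hi t k *
      ⟪ℓ (stdSimplex.vertex k), b (𝒜.chart x (stdSimplex.vertex k))⟫) * hc
  have hcont (x) : Continuous (s x (ℓ x)) :=
    (continuous_finsetSum _ fun k _ => (continuous_blockWeight lo hi k).mul continuous_const).smul
      (hℓ x).continuous
  obtain ⟨S, hS, hSs⟩ := 𝒜.glue (fun x => ⟨s x (ℓ x), hcont x⟩) (fun x x' θ hθ t => by
    have hθc : Continuous (stdSimplex.map (S := ℝ) θ) := stdSimplex.continuous_map _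
    have h1 : IsUnitSection (P ∘ 𝒜.chart x') (ℓ x ∘ stdSimplex.map θ) := by
      have : P ∘ 𝒜.chart x' = (P ∘ 𝒜.chart x) ∘ stdSimplex.map θ := funext fun t =>
        congrArg P (hθ t)
      rw [this]
      exact (hℓ x).comp hθc
    change s x' (ℓ x') t = s x (ℓ x) (stdSimplex.map θ t)
    rw [hs x' _ _ h1 (hℓ x')]
    simp only [s, Function.comp_apply, hθ, stdSimplex.map_vertex]
    congr 1
    simp only [blockWeight_map, Finset.sum_mul]
    rw [← Finset.sum_fiberwise (g := θ)]
    refine Finset.sum_congr rfl fun k _ => Finset.sum_congr rfl fun j hj => ?_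
    rw [(Finset.mem_filter.1 hj).2])
  refine ⟨S, hS, fun z => ?_, fun x ℓ' hℓ' t => ?_⟩
  · obtain ⟨x, t, rfl⟩ := 𝒜.surj z
    rw [hSs]
    simp only [s, ContinuousMap.coe_mk, map_smul]
    congr 1
    exact (hℓ x).apply_self t
  · rw [hSs]
    exact congrFun (hs x _ _ hℓ' (hℓ x)) t

/-- Let `n` line fields be given whose sections have common zeros, with unit vectors in the lines.
Then some simplex has `n + 1` vertices such that the `i`-th unit vectors at the `i`-th and the next
of them are not related by parallel transport along the simplex. -/
theorem SimplexAtlas.exists_alternating (𝒜 : SimplexAtlas Z) {n : ℕ} {P : Fin n → Z → W →L[ℝ] W}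
    (hP : ∀ i, IsLineField (P i)) (h0 : HasCommonZeros P) (b : Fin n → Z → W)
    (hb : ∀ i z, ‖b i z‖ = 1) (hPb : ∀ i z, P i z (b i z) = b i z) :
    ∃ (x : 𝒜.Index) (w : Fin (n + 1) → Fin (𝒜.dim x + 1)), StrictMono w ∧
      ∀ i ℓ, IsUnitSection (P i ∘ 𝒜.chart x) ℓ →
        ⟪ℓ (stdSimplex.vertex (w i.castSucc)),
          b i (𝒜.chart x (stdSimplex.vertex (w i.castSucc)))⟫ ≠
        ⟪ℓ (stdSimplex.vertex (w i.succ)), b i (𝒜.chart x (stdSimplex.vertex (w i.succ)))⟫ := by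
  choose S hS hPS hSx using fun i : Fin n =>
    𝒜.exists_blockSection (hP i) (b i) ((i : ℝ) / n) (((i : ℝ) + 1) / n)
  obtain ⟨z, hz⟩ := h0 S hS hPS
  obtain ⟨x, t, rfl⟩ := 𝒜.surj z
  choose ℓ hℓ using fun i => ((hP i).comp (𝒜.chart x).continuous).exists_unitSection
  let ε (i : Fin n) (k : Fin (𝒜.dim x + 1)) : ℝ :=
    ⟪ℓ i (stdSimplex.vertex k), b i (𝒜.chart x (stdSimplex.vertex k))⟫
  have hε (i k) : ε i k = 1 ∨ ε i k = -1 :=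
    (hP i).inner_eq_one_or_neg_one ((hℓ i).norm_eq_one _) ((hℓ i).apply_self _) (hb i _) (hPb i _)
  have hsum (i : Fin n) :
      ∑ k, blockWeight ((i : ℝ) / n) (((i : ℝ) + 1) / n) t k * ε i k = 0 := by
    have := (hSx i x (ℓ i) (hℓ i) t).symm.trans (hz i)
    refine (smul_eq_zero.1 this).resolve_right fun h => ?_
    have := (hℓ i).norm_eq_one t
    rw [h, norm_zero] at this
    exact zero_ne_one this
  have htot (i : Fin n) : ∑ k, blockWeight ((i : ℝ) / n) (((i : ℝ) + 1) / n) t k = (n : ℝ)⁻¹ := by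
    have hn : (0 : ℝ) < n := Nat.cast_pos.2 i.pos
    rw [sum_blockWeight (by positivity) (by gcongr; linarith)]
    · field_simp
      ring
    · rw [div_le_one hn]
      exact_mod_cast i.2
  obtain ⟨w, hw, halt⟩ := exists_strictMono_alternating ε
    (fun i k => 0 < blockWeight ((i : ℝ) / n) (((i : ℝ) + 1) / n) t k) (by
      intro i j k k' hij h h'
      refine le_of_blockWeight_pos ?_ h h'
      gcongr
      exact_mod_cast hij) (by
      intro i s
      by_contra! hcon
      -- If all labels of positive weight were `s`, the vanishing average would force `s = 0`,
      -- whereas the labels are `±1` and the total weight is positive.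
      have hs : ∑ k, blockWeight ((i : ℝ) / n) (((i : ℝ) + 1) / n) t k * s = 0 := by
        rw [← hsum i]
        refine Finset.sum_congr rfl fun k _ => ?_
        rcases (blockWeight_nonneg ((i : ℝ) / n) (((i : ℝ) + 1) / n) t k).eq_or_lt' with h | h
        · rw [h, zero_mul, zero_mul]
        · rw [hcon k h]
      have hn : (0 : ℝ) < (n : ℝ)⁻¹ := inv_pos.2 (Nat.cast_pos.2 i.pos)
      rw [← Finset.sum_mul, htot] at hs
      have hs0 : s = 0 := (mul_eq_zero.1 hs).resolve_left hn.ne'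
      have : ∑ k, blockWeight ((i : ℝ) / n) (((i : ℝ) + 1) / n) t k = 0 := by
        refine Finset.sum_eq_zero fun k _ => ?_
        rcases (blockWeight_nonneg ((i : ℝ) / n) (((i : ℝ) + 1) / n) t k).eq_or_lt' with h | h
        · exact h
        · have := hcon k h
          rw [hs0] at this
          rcases hε i k with h | h <;> rw [h] at this <;> norm_num at this
      exact hn.ne (this.symm.trans (htot i)))
  refine ⟨x, w, hw, fun i ℓ' hℓ' h => halt i ?_⟩
  obtain ⟨c, hc, hcℓ⟩ := ((hP i).comp (𝒜.chart x).continuous).unitSection_eq_or_eq_neg hℓ' (hℓ i)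
  simp only [ε, hcℓ, real_inner_smul_left]
  rw [h]

theorem units_neg_mul_ne {s t : ℤˣ} {α β : ℝ} (hα : α = 1 ∨ α = -1) (hβ : β = 1 ∨ β = -1)
    (h : ((s : ℤ) : ℝ) * α ≠ ((t : ℤ) : ℝ) * β) :
    (((-s : ℤˣ) : ℤ) : ℝ) * α = ((t : ℤ) : ℝ) * β ∧
      ((s : ℤ) : ℝ) * α = (((-t : ℤˣ) : ℤ) : ℝ) * β := by
  rcases Int.units_eq_one_or s with rfl | rfl <;> rcases Int.units_eq_one_or t with rfl | rfl <;>
    rcases hα with rfl | rfl <;> rcases hβ with rfl | rfl <;> norm_num at h <;> norm_num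

theorem IsLineField.inner_eq_of_const {X : Type*} [TopologicalSpace X] [PreconnectedSpace X]
    {P : Z → W →L[ℝ] W} (hP : IsLineField P) {f : X → Z} (z : Z) (hf : ∀ x, f x = z) {ℓ : X → W}
    (hℓ : IsUnitSection (P ∘ f) ℓ) (x y : X) : ℓ x = ℓ y := by
  have hPf : IsLineField (P ∘ f) := hP.comp (by rw [funext hf]; exact continuous_const)
  have hc : IsUnitSection (P ∘ f) fun _ => ℓ x := ⟨continuous_const, fun _ => hℓ.norm_eq_one x,
    fun y => by
      have := hℓ.apply_self x
      simpa only [Function.comp_apply, hf] using this⟩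
  obtain ⟨c, -, h⟩ := hPf.unitSection_eq_or_eq_neg hc hℓ
  rw [h x, h y]

/-- Let `n` line fields without common zero-free sections be given on a space glued from simplices.
If `T` contains all `n`-dimensional faces of the simplices along whose edges the characteristic
map is not constant, then `T` has at least `2 ^ n` elements. -/
theorem SimplexAtlas.two_pow_le_card (𝒜 : SimplexAtlas.{w} Z) {n : ℕ} {P : Fin n → Z → W →L[ℝ] W}
    (hP : ∀ i, IsLineField (P i)) (h0 : HasCommonZeros P) {ι : Type*} (T : Finset ι)
    (κ : ι → C(stdSimplex ℝ (Fin (n + 1)), Z))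
    (hκ : ∀ y ∈ T, ∀ i : Fin n,
      κ y (stdSimplex.vertex i.castSucc) ≠ κ y (stdSimplex.vertex i.succ))
    (hT : ∀ (x : 𝒜.Index) (w : Fin (n + 1) → Fin (𝒜.dim x + 1)), StrictMono w →
      (∀ i : Fin n, ∃ t : stdSimplex ℝ (Fin 2),
        𝒜.chart x (stdSimplex.map ![w i.castSucc, w i.succ] t) ≠
          𝒜.chart x (stdSimplex.vertex (w i.castSucc))) →
      ∃ y ∈ T, ∀ t, κ y t = 𝒜.chart x (stdSimplex.map w t)) :
    2 ^ n ≤ T.card := by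
  choose b hb hPb using fun i z => (hP i).exists_unit_vector z
  choose ℓ hℓ using fun i y => ((hP i).comp (κ y).continuous).exists_unitSection
  have hunit (i y) (v : stdSimplex ℝ (Fin (n + 1))) :
      ⟪ℓ i y v, b i (κ y v)⟫ = 1 ∨ ⟪ℓ i y v, b i (κ y v)⟫ = -1 :=
    (hP i).inner_eq_one_or_neg_one ((hℓ i y).norm_eq_one _) ((hℓ i y).apply_self _) (hb i _)
      (hPb i _)
  refine two_pow_le_card_of_forall_signs T
    (fun i y => κ y (stdSimplex.vertex i.castSucc)) (fun i y => κ y (stdSimplex.vertex i.succ))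
    (fun i y s t => ((s : ℤ) : ℝ) *
        ⟪ℓ i y (stdSimplex.vertex i.castSucc), b i (κ y (stdSimplex.vertex i.castSucc))⟫ ≠
      ((t : ℤ) : ℝ) * ⟪ℓ i y (stdSimplex.vertex i.succ), b i (κ y (stdSimplex.vertex i.succ))⟫)
    (fun i y hy => hκ y hy i)
    (fun i y s t h => not_not.2 (units_neg_mul_ne (hunit i y _) (hunit i y _) h).1)
    (fun i y s t h => not_not.2 (units_neg_mul_ne (hunit i y _) (hunit i y _) h).2) ?_
  intro ω
  obtain ⟨x, w, hw, halt⟩ := 𝒜.exists_alternating hP h0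
    (fun i z => ((ω i z : ℤ) : ℝ) • b i z) (fun i z => by
      rw [norm_smul, hb, mul_one]
      rcases Int.units_eq_one_or (ω i z) with h | h <;> simp [h])
    (fun i z => by rw [map_smul, hPb])
  -- Along an edge mapped to one point a unit section is constant, so its ends would give equal
  -- signs.
  obtain ⟨y, hy, hyx⟩ := hT x w hw (by
    intro i
    by_contra! hconst
    obtain ⟨ℓ', hℓ'⟩ := ((hP i).comp (𝒜.chart x).continuous).exists_unitSection
    have hθ : Continuous (stdSimplex.map (S := ℝ) ![w i.castSucc, w i.succ]) :=
      stdSimplex.continuous_map _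
    have h1 := (hP i).inner_eq_of_const (f := 𝒜.chart x ∘ stdSimplex.map ![w i.castSucc, w i.succ])
      _ hconst (hℓ'.comp hθ) (stdSimplex.vertex 0) (stdSimplex.vertex 1)
    have h2 := (hconst (stdSimplex.vertex 0)).trans (hconst (stdSimplex.vertex 1)).symm
    simp only [Function.comp_apply, stdSimplex.map_vertex, Matrix.cons_val_zero,
      Matrix.cons_val_one] at h1 h2
    refine halt i ℓ' hℓ' ?_
    rw [h1, h2])
  refine ⟨y, hy, fun i => ?_⟩
  obtain ⟨ℓ', hℓ'⟩ := ((hP i).comp (𝒜.chart x).continuous).exists_unitSection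
  have hθ : Continuous (stdSimplex.map (S := ℝ) w) := stdSimplex.continuous_map _
  have h1 : IsUnitSection (P i ∘ κ y) (ℓ' ∘ stdSimplex.map w) := by
    have : P i ∘ κ y = (P i ∘ 𝒜.chart x) ∘ stdSimplex.map w := funext fun t =>
      congrArg (P i) (hyx t)
    rw [this]
    exact hℓ'.comp hθ
  obtain ⟨c, hc, hcℓ⟩ := ((hP i).comp (κ y).continuous).unitSection_eq_or_eq_neg (hℓ i y) h1
  intro h
  refine halt i ℓ' hℓ' ?_
  -- The sections on the face and on the ambient simplex differ by one global sign `c`, which does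
  -- not affect whether two signs agree.
  have h2 (k : Fin (n + 1)) : ⟪ℓ' (stdSimplex.vertex (w k)),
      ((ω i (𝒜.chart x (stdSimplex.vertex (w k))) : ℤ) : ℝ) •
        b i (𝒜.chart x (stdSimplex.vertex (w k)))⟫ =
      c * (((ω i (κ y (stdSimplex.vertex k)) : ℤ) : ℝ) *
        ⟪ℓ i y (stdSimplex.vertex k), b i (κ y (stdSimplex.vertex k))⟫) := by
    have h3 := hcℓ (stdSimplex.vertex k)
    have h4 := hyx (stdSimplex.vertex k)
    simp only [Function.comp_apply, stdSimplex.map_vertex] at h3 h4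
    rw [h3, ← h4, real_inner_smul_left, real_inner_smul_right]
  rw [h2, h2, h]

end SimplexAtlasSections

/-! ### The line fields on the torus and on real projective space -/

theorem eq_zero_of_inner_eq_zero {W : Type*} [NormedAddCommGroup W] [InnerProductSpace ℝ W]
    {A : W →L[ℝ] W} {u v : W} (hv : A v = v) (c : ℝ) (hu : ∀ w, A w = (c * ⟪u, w⟫) • u)
    (h : ⟪v, u⟫ = 0) : v = 0 := by
  rw [← hv, hu, real_inner_comm, h, mul_zero, zero_smul]

theorem HasCommonZeros.comp_homeomorph {Z Y W : Type*} [TopologicalSpace Z] [TopologicalSpace Y]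
    [NormedAddCommGroup W] [InnerProductSpace ℝ W] {n : ℕ} {P : Fin n → Y → W →L[ℝ] W}
    (h : HasCommonZeros P) (e : Z ≃ₜ Y) : HasCommonZeros fun i => P i ∘ e := by
  intro S hS hP
  obtain ⟨y, hy⟩ := h (fun i => S i ∘ e.symm) (fun i => (hS i).comp e.symm.continuous)
    (fun i y => by simpa using hP i (e.symm y))
  exact ⟨e.symm y, hy⟩

/-- The orthogonal projection onto the line spanned by a vector. -/
noncomputable def spanProj {W : Type*} [NormedAddCommGroup W] [InnerProductSpace ℝ W] (v : W) :
    W →L[ℝ] W :=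
  (⟪v, v⟫)⁻¹ • (innerSL ℝ v).smulRight v

theorem spanProj_apply {W : Type*} [NormedAddCommGroup W] [InnerProductSpace ℝ W] (v w : W) :
    spanProj v w = ((⟪v, v⟫)⁻¹ * ⟪v, w⟫) • v := by
  simp [spanProj, smul_smul]

theorem spanProj_smul {W : Type*} [NormedAddCommGroup W] [InnerProductSpace ℝ W] {c : ℝ}
    (hc : c ≠ 0) (v : W) : spanProj (c • v) = spanProj v := by
  ext w
  rw [spanProj_apply, spanProj_apply, real_inner_smul_left, real_inner_smul_left,
    real_inner_smul_right, smul_smul]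
  congr 1
  rcases eq_or_ne (⟪v, v⟫) 0 with h | h
  · simp [inner_self_eq_zero.1 h]
  · field_simp

theorem continuousOn_spanProj {W : Type*} [NormedAddCommGroup W] [InnerProductSpace ℝ W] :
    ContinuousOn (spanProj (W := W)) {0}ᶜ := by
  have h0 : Continuous fun v : W => innerSL ℝ v := (innerSL ℝ).continuous
  have h1 : Continuous fun v : W => (innerSL ℝ v).smulRight v :=
    ((ContinuousLinearMap.smulRightL ℝ W W).continuous.comp h0).clm_apply continuous_id
  have h2 : Continuous fun v : W => ⟪v, v⟫ := continuous_id.inner continuous_id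
  exact (h2.continuousOn.inv₀ fun v hv => (inner_self_ne_zero (𝕜 := ℝ)).2 hv).smul h1.continuousOn

/-! ### The tautological line bundle -/

namespace RealProjectiveSpace

variable {n : ℕ}

/-- The point of `ℝPⁿ` with given homogeneous coordinates. -/
noncomputable def mk (v : Fin (n + 1) → ℝ) (hv : v ≠ 0) : RealProjectiveSpace n :=
  Projectivization.mk ℝ v hv

theorem ind {motive : RealProjectiveSpace n → Prop} (h : ∀ v hv, motive (mk v hv)) (p) : motive p :=
  Projectivization.ind h p

theorem mk_eq_mk_iff {v w : Fin (n + 1) → ℝ} (hv : v ≠ 0) (hw : w ≠ 0) :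
    mk v hv = mk w hw ↔ ∃ c : ℝ, c • w = v :=
  Projectivization.mk_eq_mk_iff' ℝ v w hv hw

theorem line_mk (v : Fin (n + 1) → ℝ) (hv : v ≠ 0) : (mk v hv).line = Submodule.span ℝ {v} :=
  Projectivization.submodule_mk v hv

theorem continuous_mk : Continuous fun v : {v : Fin (n + 1) → ℝ // v ≠ 0} => mk v.1 v.2 :=
  continuous_coinduced_rng

theorem continuous_iff {Y : Type*} [TopologicalSpace Y] {f : RealProjectiveSpace n → Y} :
    Continuous f ↔ Continuous fun v : {v : Fin (n + 1) → ℝ // v ≠ 0} => f (mk v.1 v.2) :=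
  continuous_coinduced_dom

/-- The orthogonal projection onto the line which a point of `ℝPⁿ` is. -/
noncomputable def proj (p : RealProjectiveSpace n) :
    EuclideanSpace ℝ (Fin (n + 1)) →L[ℝ] EuclideanSpace ℝ (Fin (n + 1)) :=
  spanProj (WithLp.toLp 2 (Projectivization.rep p))

theorem proj_mk (v : Fin (n + 1) → ℝ) (hv : v ≠ 0) : (mk v hv).proj = spanProj (WithLp.toLp 2 v) := by
  obtain ⟨a, ha⟩ := Projectivization.exists_smul_eq_mk_rep ℝ v hv
  have : Projectivization.rep (mk v hv) = (a : ℝ) • v := ha.symm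
  rw [proj, this, WithLp.toLp_smul, spanProj_smul a.ne_zero]

theorem isLineField_proj : IsLineField (proj (n := n)) where
  continuous := by
    rw [continuous_iff]
    simp only [proj_mk]
    refine continuousOn_spanProj.comp_continuous
      ((PiLp.continuous_toLp 2 _).comp continuous_subtype_val) fun v => ?_
    simpa using v.2
  exists_unit p := by
    induction p using ind with
    | h v hv =>
      have hv' : WithLp.toLp 2 v ≠ 0 := by simpa using hv
      have hn : ‖WithLp.toLp 2 v‖ ≠ 0 := norm_ne_zero_iff.2 hv'
      refine ⟨‖WithLp.toLp 2 v‖⁻¹ • WithLp.toLp 2 v, ?_, fun w => ?_⟩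
      · rw [norm_smul, norm_inv, norm_norm, inv_mul_cancel₀ hn]
      · rw [proj_mk, spanProj_apply, real_inner_smul_left, smul_smul, real_inner_self_eq_norm_sq]
        congr 1
        field_simp

/-- The cube is mapped onto a hemisphere up to scaling. Pairing the sections with the homogeneous
coordinates gives functions that are odd on the boundary. -/
theorem hasCommonZeros : HasCommonZeros fun _ : Fin n => proj (n := n) := by
  intro S hS hP
  -- The extra coordinate vanishes exactly on the boundary of the cube, where hence `q (-x) = -q x`.
  let q (x : Fin n → ℝ) : Fin (n + 1) → ℝ := Fin.cons (1 - ‖x‖) x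
  have hq (x) : q x ≠ 0 := by
    intro h
    have h1 : x = 0 := funext fun j => congrFun h j.succ
    have h2 : 1 - ‖x‖ = 0 := congrFun h 0
    simp [h1] at h2
  have hqc : Continuous q := by
    refine continuous_pi fun j => ?_
    refine Fin.cases ?_ (fun j => ?_) j
    · exact continuous_const.sub continuous_norm
    · exact continuous_apply j
  obtain ⟨x, hx⟩ := exists_common_zero_of_odd_on_boundary
    (fun i x => ⟪S i (mk (q x) (hq x)), WithLp.toLp 2 (q x)⟫) (fun i => by
      refine ((hS i).comp (continuous_mk.comp (hqc.subtype_mk hq))).inner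
        ((PiLp.continuous_toLp 2 _).comp hqc)) (by
      intro i x hx
      have h1 : q (-x) = -q x := by
        funext j
        refine Fin.cases ?_ (fun j => ?_) j
        · simp [q, hx]
        · simp [q]
      have h2 : mk (q (-x)) (hq (-x)) = mk (q x) (hq x) :=
        (mk_eq_mk_iff _ _).2 ⟨-1, by rw [h1, neg_one_smul]⟩
      rw [h2, h1, WithLp.toLp_neg, inner_neg_right])
  refine ⟨mk (q x) (hq x), fun i => ?_⟩
  refine eq_zero_of_inner_eq_zero (hP i _) (⟪WithLp.toLp 2 (q x), WithLp.toLp 2 (q x)⟫)⁻¹ (fun w => ?_) (hx i)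
  simp only [proj_mk, spanProj_apply]

end RealProjectiveSpace

/-! ### The Möbius bundles -/

namespace Torus

variable {n : ℕ}

/-- The orthogonal projection onto the line of `ℂ` spanned by the square roots of a coordinate. -/
noncomputable def sqrtProj (j : Fin n) (y : Torus n) : ℂ →L[ℝ] ℂ :=
  (2⁻¹ : ℝ) • (ContinuousLinearMap.id ℝ ℂ +
    (ContinuousLinearMap.mul ℝ ℂ (y j : ℂ)).comp (Complex.conjCLE : ℂ →L[ℝ] ℂ))

theorem sqrtProj_apply {j : Fin n} {y : Torus n} {u : Circle} (hu : u * u = y j) (w : ℂ) :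
    sqrtProj j y w = ⟪(u : ℂ), w⟫ • (u : ℂ) := by
  have h1 : (u : ℂ) * (starRingEnd ℂ) u = 1 := by
    rw [Complex.mul_conj, Circle.normSq_coe, Complex.ofReal_one]
  have h2 : ((⟪(u : ℂ), w⟫ : ℝ) : ℂ) =
      ((starRingEnd ℂ) u * w + u * (starRingEnd ℂ) w) / 2 := by
    rw [Complex.inner]
    rw [Complex.re_eq_add_conj]
    simp
    ring
  rw [Complex.real_smul, h2]
  simp only [sqrtProj, ← hu, smul_apply, add_apply, ContinuousLinearMap.coe_id', id_eq,
    ContinuousLinearMap.comp_apply, ContinuousLinearMap.mul_apply', Circle.coe_mul,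
    Complex.real_smul, ContinuousLinearEquiv.coe_coe, Complex.conjCLE_apply]
  push_cast
  linear_combination (-w / 2) * h1

theorem isLineField_sqrtProj (j : Fin n) : IsLineField (sqrtProj j) where
  continuous := by
    have h : Continuous fun y : Torus n => (y j : ℂ) := by fun_prop
    have h1 : Continuous fun y : Torus n => ContinuousLinearMap.mul ℝ ℂ (y j : ℂ) :=
      (ContinuousLinearMap.mul ℝ ℂ).continuous.comp h
    have h2 : Continuous fun y : Torus n => (ContinuousLinearMap.mul ℝ ℂ (y j : ℂ)).comp
        (Complex.conjCLE : ℂ →L[ℝ] ℂ) := h1.clm_comp continuous_const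
    exact (h2.const_add (ContinuousLinearMap.id ℝ ℂ)).const_smul (2⁻¹ : ℝ)
  exists_unit y := by
    refine ⟨(Circle.exp (Complex.arg (y j) / 2) : ℂ), Circle.norm_coe _, sqrtProj_apply ?_⟩
    rw [← Circle.exp_add, add_halves, Circle.exp_arg]

/-- On the cube the `i`-th line is spanned by the square root `s (x i)` of the `i`-th coordinate,
which changes sign between opposite faces; pairing with it makes the sections antiperiodic in
direction `i` and periodic in the others. -/
theorem hasCommonZeros : HasCommonZeros fun j : Fin n => sqrtProj j := by
  intro S hS hP
  let q (x : Fin n → ℝ) : Torus n := fun j => Circle.exp (Real.pi * x j)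
  have hqc : Continuous q := by fun_prop
  let s (r : ℝ) : ℂ := Circle.exp (Real.pi * r / 2)
  have hsc : Continuous s := by fun_prop
  have hpi (r : ℝ) (hr : abs r = 1) : Circle.exp (Real.pi * -r) = Circle.exp (Real.pi * r) ∧
      s (-r) = -s r := by
    have h1 : (Circle.exp (Real.pi * 1) : ℂ) = -1 := by simp
    have h2 : (Circle.exp (Real.pi * -1) : ℂ) = -1 := by
      rw [mul_neg, Circle.exp_neg, Circle.coe_inv, h1]
      norm_num
    have h3 (r : ℝ) (hr : abs r = 1) : (Circle.exp (Real.pi * r) : ℂ) = -1 := by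
      rcases (abs_eq zero_le_one).1 hr with rfl | rfl <;> assumption
    refine ⟨Circle.ext ((h3 _ (by rwa [abs_neg])).trans (h3 r hr).symm), ?_⟩
    have h4 : Real.pi * -r / 2 = Real.pi * r / 2 + Real.pi * -r := by ring
    simp only [s]
    rw [h4, Circle.exp_add, Circle.coe_mul, h3 _ (by rwa [abs_neg]), mul_neg_one]
  obtain ⟨x, hx⟩ := exists_common_zero_of_antiperiodic
    (fun i x => ⟪S i (q x), s (x i)⟫) (fun i =>
      ((hS i).comp hqc).inner (hsc.comp (continuous_apply i))) (by
      intro i j x hx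
      have h1 : q (Function.update x j (-x j)) = q x := by
        funext k
        rcases eq_or_ne k j with rfl | h
        · simp only [q, Function.update_self, (hpi _ hx).1]
        · simp only [q, Function.update_of_ne h]
      simp only [h1]
      rcases eq_or_ne i j with rfl | h
      · simp [(hpi _ hx).2]
      · simp [h])
  refine ⟨q x, fun i => ?_⟩
  refine eq_zero_of_inner_eq_zero (hP i _) 1 (fun w => ?_) (hx i)
  rw [one_mul]
  refine sqrtProj_apply ?_ w
  rw [← Circle.exp_add, add_halves]

end Torus

end LineFields

/-- The lower bound for the number of `n`-dimensional faces of a torus or a projective space which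
is glued from simplices. -/
theorem SimplexAtlas.two_pow_le_card_of_homeomorph {Z : Type*} [TopologicalSpace Z]
    (𝒜 : SimplexAtlas.{w} Z) {n : ℕ}
    (h : Nonempty (Z ≃ₜ Torus n) ∨ Nonempty (Z ≃ₜ RealProjectiveSpace n)) {ι : Type*} (T : Finset ι)
    (κ : ι → C(stdSimplex ℝ (Fin (n + 1)), Z))
    (hκ : ∀ y ∈ T, ∀ i : Fin n,
      κ y (stdSimplex.vertex i.castSucc) ≠ κ y (stdSimplex.vertex i.succ))
    (hT : ∀ (x : 𝒜.Index) (w : Fin (n + 1) → Fin (𝒜.dim x + 1)), StrictMono w →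
      (∀ i : Fin n, ∃ t : stdSimplex ℝ (Fin 2),
        𝒜.chart x (stdSimplex.map ![w i.castSucc, w i.succ] t) ≠
          𝒜.chart x (stdSimplex.vertex (w i.castSucc))) →
      ∃ y ∈ T, ∀ t, κ y t = 𝒜.chart x (stdSimplex.map w t)) :
    2 ^ n ≤ T.card := by
  obtain ⟨⟨e⟩⟩ | ⟨⟨e⟩⟩ := h
  · exact 𝒜.two_pow_le_card (fun j => (Torus.isLineField_sqrtProj j).comp e.continuous)
      (Torus.hasCommonZeros.comp_homeomorph e) T κ hκ hT
  · exact 𝒜.two_pow_le_card (fun _ => RealProjectiveSpace.isLineField_proj.comp e.continuous)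
      (RealProjectiveSpace.hasCommonZeros.comp_homeomorph e) T κ hκ hT

/-! ### Simplicial complexes -/

namespace AbstractSimplicialComplex

variable {V : Type v} (K : AbstractSimplicialComplex V)

theorem Realization.continuous_iff {K : AbstractSimplicialComplex V} {Y : Type*}
    [TopologicalSpace Y] {f : K.Realization → Y} :
    Continuous f ↔ ∀ s : K.faces, @Continuous _ _
      (TopologicalSpace.induced (fun p : K.closedSimplex s.1 => (p.1.1 : V → ℝ)) inferInstance) _
      fun p : K.closedSimplex s.1 => f p.1 :=
  continuous_iSup_dom.trans (forall_congr' fun _ => continuous_coinduced_dom)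

theorem Realization.continuous_of_forall_mem_closedSimplex {K : AbstractSimplicialComplex V}
    {Y : Type*} [TopologicalSpace Y] {f : Y → K.Realization} (s : K.faces)
    (hs : ∀ y, f y ∈ K.closedSimplex s.1) (hf : Continuous fun y => (f y).1) : Continuous f := by
  refine continuous_iSup_rng (i := s) ?_
  let : TopologicalSpace (K.closedSimplex s.1) :=
    TopologicalSpace.induced (fun p : K.closedSimplex s.1 => (p.1.1 : V → ℝ)) inferInstance
  have h1 : Continuous fun y => (⟨f y, hs y⟩ : K.closedSimplex s.1) :=
    continuous_induced_rng.2 hf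
  have h2 : @Continuous (K.closedSimplex s.1) K.Realization _
    (TopologicalSpace.coinduced Subtype.val inferInstance) Subtype.val := continuous_coinduced_rng
  exact @Continuous.comp _ _ _ _ _ (TopologicalSpace.coinduced Subtype.val inferInstance)
    (fun y => (⟨f y, hs y⟩ : K.closedSimplex s.1)) Subtype.val h2 h1

variable [LinearOrder V]

/-- The faces of a simplicial complex with ordered vertices, as increasing sequences. -/
structure FlagSimplex where
  dim : ℕ
  vertex : Fin (dim + 1) ↪o V
  mem : Finset.univ.map vertex.toEmbedding ∈ K.faces

namespace FlagSimplex

variable {K} (x x' : K.FlagSimplex)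

theorem sum_ite (t : Fin (x.dim + 1) → ℝ) (k : Fin (x.dim + 1)) :
    ∑ j, (if x.vertex j = x.vertex k then t j else 0) = t k := by
  simp

/-- The point of a face with given barycentric coordinates. -/
noncomputable def toRealization (t : stdSimplex ℝ (Fin (x.dim + 1))) : K.Realization :=
  ⟨fun a => ∑ k, if x.vertex k = a then t k else 0,
    fun a => Finset.sum_nonneg fun k _ => by split_ifs <;> simp,
    _, x.mem, fun a ha => Finset.sum_eq_zero fun k _ => if_neg fun h => ha (by simp [← h]), by
      rw [Finset.sum_map]
      refine (Finset.sum_congr rfl fun k _ => x.sum_ite t k).trans (stdSimplex.sum_eq_one t)⟩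

theorem toRealization_apply (t : stdSimplex ℝ (Fin (x.dim + 1))) (a : V) :
    (x.toRealization t).1 a = ∑ k, if x.vertex k = a then t k else 0 :=
  rfl

theorem toRealization_apply_vertex (t : stdSimplex ℝ (Fin (x.dim + 1))) (k : Fin (x.dim + 1)) :
    (x.toRealization t).1 (x.vertex k) = t k :=
  x.sum_ite t k

theorem toRealization_apply_of_notMem (t : stdSimplex ℝ (Fin (x.dim + 1))) {a : V}
    (ha : a ∉ Set.range x.vertex) : (x.toRealization t).1 a = 0 := by
  rw [toRealization_apply]
  exact Finset.sum_eq_zero fun k _ => if_neg fun h => ha ⟨k, h⟩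

theorem toRealization_injective : Function.Injective x.toRealization := by
  intro t t' h
  refine stdSimplex.ext (funext fun k => ?_)
  rw [← x.toRealization_apply_vertex, ← x.toRealization_apply_vertex, h]

theorem continuous_toRealization : Continuous x.toRealization := by
  refine Realization.continuous_of_forall_mem_closedSimplex ⟨_, x.mem⟩
    (fun t a ha => x.toRealization_apply_of_notMem t fun ⟨k, hk⟩ => ha (by simp [← hk])) ?_
  refine continuous_pi fun a => ?_
  simp only [toRealization_apply]
  refine continuous_finsetSum _ fun k _ => ?_
  split_ifs
  · exact (continuous_apply k).comp continuous_subtype_val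
  · exact continuous_const

variable {x x'}

theorem toRealization_map (θ : Fin (x'.dim + 1) → Fin (x.dim + 1))
    (h : ∀ k, x.vertex (θ k) = x'.vertex k) (t : stdSimplex ℝ (Fin (x'.dim + 1))) :
    x'.toRealization t = x.toRealization (stdSimplex.map θ t) := by
  refine Subtype.ext (funext fun a => ?_)
  simp only [toRealization_apply, stdSimplex.map_apply_eq_sum]
  rw [← Finset.sum_fiberwise (g := θ)]
  refine Finset.sum_congr rfl fun k _ => ?_
  split_ifs with hk
  · refine Finset.sum_congr rfl fun j hj => if_pos ?_
    rw [← h, (Finset.mem_filter.1 hj).2, hk]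
  · refine Finset.sum_eq_zero fun j hj => if_neg ?_
    rwa [← h, (Finset.mem_filter.1 hj).2]

theorem exists_of_mem_faces {s : Finset V} (hs : s ∈ K.faces) :
    ∃ x : K.FlagSimplex, Set.range x.vertex = s := by
  have h : s.card = s.card - 1 + 1 :=
    (Nat.sub_add_cancel (Finset.card_pos.2 (K.isRelLowerSet_faces hs).1)).symm
  have hr := Finset.range_orderEmbOfFin s h
  refine ⟨⟨s.card - 1, s.orderEmbOfFin h, ?_⟩, hr⟩
  convert hs
  refine Finset.coe_injective ?_
  rw [← hr]
  simp

theorem exists_toRealization_eq (p : K.Realization) (hp : ∀ a, a ∉ Set.range x.vertex → p.1 a = 0) :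
    ∃ h, x.toRealization ⟨fun k => p.1 (x.vertex k), h⟩ = p := by
  obtain ⟨s, hs, hs0, hs1⟩ := p.2.2
  have h1 : ∑ k, p.1 (x.vertex k) = 1 := by
    refine Eq.trans ?_ hs1
    refine (Finset.sum_map Finset.univ x.vertex.toEmbedding p.1).symm.trans ?_
    refine (Finset.sum_subset (s₁ := Finset.univ.map x.vertex.toEmbedding ∩ s)
      Finset.inter_subset_left fun a ha ha' => ?_).symm.trans
      (Finset.sum_subset Finset.inter_subset_right fun a ha ha' => ?_)
    · exact hs0 a fun h => ha' (Finset.mem_inter.2 ⟨ha, h⟩)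
    · refine hp a fun h => ha' (Finset.mem_inter.2 ⟨?_, ha⟩)
      simpa using h
  refine ⟨⟨fun k => p.2.1 _, h1⟩, Subtype.ext (funext fun a => ?_)⟩
  by_cases ha : a ∈ Set.range x.vertex
  · obtain ⟨k, rfl⟩ := ha
    rw [toRealization_apply_vertex]
    rfl
  · rw [toRealization_apply_of_notMem _ _ ha, hp a ha]

theorem exists_toRealization (p : K.Realization) :
    ∃ (x : K.FlagSimplex) (t : _), x.toRealization t = p := by
  obtain ⟨s, hs, hs0, -⟩ := p.2.2
  obtain ⟨x, hx⟩ := exists_of_mem_faces hs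
  obtain ⟨h, hp⟩ := exists_toRealization_eq (x := x) p fun a ha => hs0 a (by rwa [hx] at ha)
  exact ⟨x, _, hp⟩

theorem exists_face_map (h : Set.range x'.vertex ⊆ Set.range x.vertex) :
    ∃ θ : Fin (x'.dim + 1) →o Fin (x.dim + 1), ∀ k, x.vertex (θ k) = x'.vertex k := by
  choose θ hθ using fun k => h (Set.mem_range_self k)
  refine ⟨⟨θ, fun k k' hk => ?_⟩, hθ⟩
  rw [← x.vertex.le_iff_le, hθ, hθ]
  exact x'.vertex.monotone hk

end FlagSimplex

namespace FlagSimplex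

variable {K}

/-- A common point is supported on the common vertices, hence lies in a common face, and both values
equal the value there. -/
theorem eq_of_toRealization_eq {W : Type*}
    (s : ∀ x : K.FlagSimplex, stdSimplex ℝ (Fin (x.dim + 1)) → W)
    (hs : ∀ (x x' : K.FlagSimplex) (θ : Fin (x'.dim + 1) →o Fin (x.dim + 1)),
      (∀ t, x'.toRealization t = x.toRealization (stdSimplex.map θ t)) →
        ∀ t, s x' t = s x (stdSimplex.map θ t))
    {x x' : K.FlagSimplex} {t : stdSimplex ℝ (Fin (x.dim + 1))}
    {t' : stdSimplex ℝ (Fin (x'.dim + 1))} (h : x.toRealization t = x'.toRealization t') :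
    s x t = s x' t' := by
  let σ := Finset.univ.map x.vertex.toEmbedding ∩ Finset.univ.map x'.vertex.toEmbedding
  have h0 (a : V) (ha : a ∉ σ) : (x.toRealization t).1 a = 0 := by
    by_contra hne
    refine ha (Finset.mem_inter.2 ⟨?_, ?_⟩)
    · by_contra hx
      exact hne (x.toRealization_apply_of_notMem t (by simpa using hx))
    · by_contra hx
      refine hne ?_
      rw [h]
      exact x'.toRealization_apply_of_notMem t' (by simpa using hx)
  have hne : σ.Nonempty := by
    rw [Finset.nonempty_iff_ne_empty]
    intro hσ
    obtain ⟨s, -, -, hs1⟩ := (x.toRealization t).2.2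
    rw [Finset.sum_eq_zero fun a _ => h0 a (by simp [hσ])] at hs1
    exact zero_ne_one hs1
  obtain ⟨x'', hx''⟩ := exists_of_mem_faces
    ((K.isRelLowerSet_faces x.mem).2 (Finset.inter_subset_left : σ ≤ _) hne)
  obtain ⟨ht'', hp⟩ := exists_toRealization_eq (x := x'') (x.toRealization t) fun a ha =>
    h0 a (by rwa [hx''] at ha)
  obtain ⟨θ, hθ⟩ := exists_face_map (x := x) (x' := x'') (by
    rw [hx'']
    intro a ha
    simpa using (Finset.mem_inter.1 ha).1)
  obtain ⟨θ', hθ'⟩ := exists_face_map (x := x') (x' := x'') (by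
    rw [hx'']
    intro a ha
    simpa using (Finset.mem_inter.1 ha).2)
  have h1 := toRealization_map _ hθ
  have h2 := toRealization_map _ hθ'
  rw [x.toRealization_injective (hp.symm.trans (h1 _)), ← hs _ _ _ h1,
    x'.toRealization_injective ((h.symm.trans hp.symm).trans (h2 _)), ← hs _ _ _ h2]

end FlagSimplex

/-- The realization of a simplicial complex is glued from its faces. -/
noncomputable def atlas : SimplexAtlas K.Realization where
  Index := K.FlagSimplex
  dim := FlagSimplex.dim
  chart x := ⟨x.toRealization, x.continuous_toRealization⟩
  surj := FlagSimplex.exists_toRealization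
  glue {W} _ s hs := by
    have key {x x' : K.FlagSimplex} {t t'} (h : x.toRealization t = x'.toRealization t') :
        s x t = s x' t' := FlagSimplex.eq_of_toRealization_eq (fun x t => s x t) hs h
    choose x t hxt using FlagSimplex.exists_toRealization (K := K)
    refine ⟨fun p => s (x p) (t p), Realization.continuous_iff.2 fun σ => ?_,
      fun y u => key (hxt _)⟩
    obtain ⟨y, hy⟩ := FlagSimplex.exists_of_mem_faces σ.2
    let : TopologicalSpace (K.closedSimplex σ.1) :=
      TopologicalSpace.induced (fun p : K.closedSimplex σ.1 => (p.1.1 : V → ℝ)) inferInstance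
    have hval : Continuous fun p : K.closedSimplex σ.1 => (p.1.1 : V → ℝ) :=
      continuous_induced_dom
    choose h hp using fun p : K.closedSimplex σ.1 =>
      FlagSimplex.exists_toRealization_eq (x := y) p.1 fun a ha => p.2 a (by rwa [hy] at ha)
    have h1 : (fun p : K.closedSimplex σ.1 => s (x p.1) (t p.1)) =
        fun p => s y ⟨fun k => p.1.1 (y.vertex k), h p⟩ :=
      funext fun p => key ((hxt _).trans (hp p).symm)
    rw [h1]
    exact (s y).continuous.comp (Continuous.subtype_mk
      (continuous_pi fun k => (continuous_apply (y.vertex k)).comp hval) _)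

end AbstractSimplicialComplex

theorem AbstractSimplicialComplex.two_pow_le_encard_facesOfDim {V : Type v}
    (K : AbstractSimplicialComplex V) {n : ℕ}
    (h : Nonempty (K.Realization ≃ₜ Torus n) ∨ Nonempty (K.Realization ≃ₜ RealProjectiveSpace n)) :
    (2 ^ n : ℕ∞) ≤ (K.facesOfDim n).encard := by
  -- Any linear order of the vertices serves.
  obtain ⟨_, -⟩ := exists_wellFoundedLT V
  rcases (K.facesOfDim n).finite_or_infinite with hfin | hinf
  swap
  · rw [hinf.encard_eq]
    exact le_top
  have := hfin.fintype
  have hmem (y : K.facesOfDim n) :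
      Finset.univ.map (y.1.orderEmbOfFin y.2.2).toEmbedding ∈ K.faces := by
    rw [Finset.map_orderEmbOfFin_univ]
    exact y.2.1
  let X (y : K.facesOfDim n) : K.FlagSimplex := ⟨n, y.1.orderEmbOfFin y.2.2, hmem y⟩
  have key := K.atlas.two_pow_le_card_of_homeomorph h (Finset.univ : Finset (K.facesOfDim n))
    (fun y => K.atlas.chart (X y)) ?_ ?_
  · rw [← Set.coe_fintypeCard]
    exact_mod_cast key
  · intro y _ i hi
    have := stdSimplex.vertex_injective ((X y).toRealization_injective hi)
    exact i.castSucc_lt_succ.ne this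
  · intro x w hw _
    let v : Fin (n + 1) ↪o V := (OrderEmbedding.ofStrictMono w hw).trans x.vertex
    have hface : Finset.univ.map v.toEmbedding ∈ K.faces := by
      refine (K.isRelLowerSet_faces x.mem).2 ?_ (by simp)
      intro a ha
      obtain ⟨k, -, rfl⟩ := Finset.mem_map.1 ha
      exact Finset.mem_map.2 ⟨w k, Finset.mem_univ _, rfl⟩
    let y : K.facesOfDim n := ⟨_, hface, by simp⟩
    refine ⟨y, Finset.mem_univ _, fun t => ?_⟩
    refine FlagSimplex.toRealization_map (x := x) (x' := X y) w (fun k => ?_) t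
    have h1 : v = y.1.orderEmbOfFin y.2.2 :=
      Finset.orderEmbOfFin_unique' _ fun k => by simp [y]
    exact DFunLike.congr_fun h1 k

/-! ### The geometric realization of a simplicial set -/

namespace SSet

variable (X : SSet.{u})

/-- The characteristic map of a simplex. -/
noncomputable def chart {m : ℕ} (x : X _⦋m⦌) :
    C(_root_.stdSimplex ℝ (Fin (m + 1)), SSet.toTop.obj X) :=
  TopCat.toSSetObjEquiv (SSet.toTop.obj X) (op ⦋m⦌) ((sSetTopAdj.unit.app X).app (op ⦋m⦌) x)

variable {X}

theorem chart_map {m m' : ℕ} (f : ⦋m'⦌ ⟶ ⦋m⦌) (x : X _⦋m⦌)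
    (t : _root_.stdSimplex ℝ (Fin (m' + 1))) :
    X.chart (X.map f.op x) t = X.chart x (stdSimplex.map f t) := by
  have h := ConcreteCategory.congr_hom ((sSetTopAdj.unit.app X).naturality f.op) x
  exact congrArg (fun z => TopCat.toSSetObjEquiv (SSet.toTop.obj X) (op ⦋m'⦌) z t) h

theorem toTop_map_chart {Y : SSet.{u}} (φ : X ⟶ Y) {m : ℕ} (x : X _⦋m⦌)
    (t : _root_.stdSimplex ℝ (Fin (m + 1))) :
    SSet.toTop.map φ (X.chart x t) = Y.chart (φ.app _ x) t := by
  have h := ConcreteCategory.congr_hom (NatTrans.congr_app (sSetTopAdj.unit.naturality φ) (op ⦋m⦌)) x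
  have h' := congrArg (fun z => TopCat.toSSetObjEquiv (SSet.toTop.obj Y) (op ⦋m⦌) z t) h
  exact h'.symm

theorem hom_ext_of_chart {Y : TopCat.{u}} {g g' : SSet.toTop.obj X ⟶ Y}
    (h : ∀ (m : ℕ) (x : X _⦋m⦌) (t), g (X.chart x t) = g' (X.chart x t)) : g = g' := by
  refine (sSetTopAdj.homEquiv X Y).injective ?_
  ext ⟨m⟩ x
  refine (TopCat.toSSetObjEquiv Y (op m)).injective (ContinuousMap.ext fun t => ?_)
  rw [Adjunction.homEquiv_unit, Adjunction.homEquiv_unit]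
  exact h m.len x t

theorem exists_hom_of_chart {Y : TopCat.{u}}
    (s : ∀ (m : ℕ), X _⦋m⦌ → C(_root_.stdSimplex ℝ (Fin (m + 1)), Y))
    (hs : ∀ (m m' : ℕ) (f : ⦋m'⦌ ⟶ ⦋m⦌) (x : X _⦋m⦌) (t),
      s m' (X.map f.op x) t = s m x (stdSimplex.map f t)) :
    ∃ g : SSet.toTop.obj X ⟶ Y, ∀ (m : ℕ) (x : X _⦋m⦌) (t), g (X.chart x t) = s m x t := by
  let φ : X ⟶ TopCat.toSSet.obj Y :=
    { app := fun m => ↾fun x => (TopCat.toSSetObjEquiv Y m).symm (s m.unop.len x)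
      naturality := fun m m' f => by
        ext x
        refine (TopCat.toSSetObjEquiv Y m').injective (ContinuousMap.ext fun t => ?_)
        exact hs m.unop.len m'.unop.len f.unop x t }
  refine ⟨(sSetTopAdj.homEquiv X Y).symm φ, fun m x t => ?_⟩
  have h := (sSetTopAdj.homEquiv X Y).apply_symm_apply φ
  rw [Adjunction.homEquiv_unit] at h
  have h' := ConcreteCategory.congr_hom (NatTrans.congr_app h (op ⦋m⦌)) x
  exact congrArg (fun z => TopCat.toSSetObjEquiv Y (op ⦋m⦌) z t) h'

/-- The indicator of the points covered by simplices, with values in an indiscrete space, is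
continuous and agrees with the constant `True` on all simplices, hence everywhere. -/
theorem exists_chart_eq (p : SSet.toTop.obj X) : ∃ (m : ℕ) (x : X _⦋m⦌) (t : _), X.chart x t = p := by
  classical
  let : TopologicalSpace (ULift.{u} Prop) := ⊤
  let g : SSet.toTop.obj X ⟶ TopCat.of (ULift.{u} Prop) :=
    TopCat.ofHom ⟨fun p => ⟨∃ (m : ℕ) (x : X _⦋m⦌) (t : _), X.chart x t = p⟩, continuous_top⟩
  let g' : SSet.toTop.obj X ⟶ TopCat.of (ULift.{u} Prop) :=
    TopCat.ofHom ⟨fun p => ⟨True⟩, continuous_top⟩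
  have h : g = g' := hom_ext_of_chart fun m x t =>
    congrArg ULift.up (eq_true ⟨m, x, t, rfl⟩)
  have := congrArg (fun k : SSet.toTop.obj X ⟶ TopCat.of (ULift.{u} Prop) => (k p).down) h
  exact of_eq_true this

variable (X) in
/-- The realization of a simplicial set is glued from its simplices. -/
noncomputable def atlas : SimplexAtlas (SSet.toTop.obj X) where
  Index := Σ m : ℕ, X _⦋m⦌
  dim x := x.1
  chart x := X.chart x.2
  surj p := by
    obtain ⟨m, x, t, h⟩ := exists_chart_eq p
    exact ⟨⟨m, x⟩, t, h⟩
  glue {W} _ s hs := by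
    obtain ⟨g, hg⟩ := exists_hom_of_chart (X := X) (Y := TopCat.of (ULift.{u} W))
      (fun m x => (ContinuousMap.mk ULift.up continuous_uliftUp).comp (s ⟨m, x⟩))
      (fun m m' f x t => congrArg ULift.up
        (hs ⟨m, x⟩ ⟨m', X.map f.op x⟩ f.toOrderHom (fun t => chart_map f x t) t))
    exact ⟨fun p => (g p).down, continuous_uliftDown.comp g.hom.continuous,
      fun x t => congrArg ULift.down (hg x.1 x.2 t)⟩

theorem realizationPoint_eq_chart (X : SSet.{0}) {m : ℕ} (x : X _⦋m⦌)
    (t : _root_.stdSimplex ℝ (Fin (m + 1))) : X.realizationPoint x t = X.chart x t := by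
  have h := sSetTopAdj_unit_app_app_down X (op ⦋m⦌) x
  exact (congrArg (fun k : SimplexCategory.toTop.obj ⦋m⦌ ⟶ SSet.toTop.obj X => k (ULift.up t)) h).symm

end SSet

theorem stdSimplex.map_const {m m' : ℕ} (c : Fin (m + 1)) (t : stdSimplex ℝ (Fin (m' + 1))) :
    stdSimplex.map (fun _ => c) t = stdSimplex.vertex c := by
  refine stdSimplex.ext (funext fun k => ?_)
  rw [stdSimplex.map_apply_eq_sum, stdSimplex.vertex_coe]
  rcases eq_or_ne k c with rfl | h
  · simp
  · simp [h, h.symm]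

/-! ### Edges and vertices of simplices in a regular simplicial set -/

namespace SSet

variable {X : SSet.{u}}

/-- The `k`-th vertex of a simplex. -/
def vtx {m : ℕ} (x : X _⦋m⦌) (k : Fin (m + 1)) : X _⦋0⦌ :=
  X.map (SimplexCategory.const ⦋0⦌ ⦋m⦌ k).op x

theorem map_map_apply {m m' m'' : ℕ} (f : ⦋m'⦌ ⟶ ⦋m⦌) (g : ⦋m''⦌ ⟶ ⦋m'⦌) (x : X _⦋m⦌) :
    X.map g.op (X.map f.op x) = X.map (g ≫ f).op x := by
  rw [op_comp, Functor.map_comp]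
  rfl

theorem vtx_map {m m' : ℕ} (f : ⦋m'⦌ ⟶ ⦋m⦌) (x : X _⦋m⦌) (k : Fin (m' + 1)) :
    vtx (X.map f.op x) k = vtx x (f.toOrderHom k) := by
  rw [vtx, map_map_apply, SimplexCategory.const_comp]
  rfl

/-- The total barycentric weight on a given vertex is a continuous function on the realization and
separates that vertex from the others. -/
theorem vtx_eq_of_chart_eq {m m' : ℕ} {x : X _⦋m⦌} {x' : X _⦋m'⦌} {k : Fin (m + 1)}
    {k' : Fin (m' + 1)}
    (h : X.chart x (stdSimplex.vertex k) = X.chart x' (stdSimplex.vertex k')) :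
    vtx x k = vtx x' k' := by
  classical
  obtain ⟨g, hg⟩ := exists_hom_of_chart (X := X) (Y := TopCat.of (ULift.{u} ℝ))
    (fun m x => ⟨fun t => ⟨∑ j, if vtx x j = vtx x' k' then t j else 0⟩,
      continuous_uliftUp.comp (continuous_finsetSum _ fun j _ => by
        split_ifs
        · exact (continuous_apply j).comp continuous_subtype_val
        · exact continuous_const)⟩)
    (fun m m' f x t => by
      refine congrArg ULift.up ?_
      simp only [vtx_map]
      rw [← Finset.sum_fiberwise (g := f.toOrderHom)]
      refine Finset.sum_congr rfl fun j _ => ?_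
      split_ifs with hj
      · refine Eq.trans (Finset.sum_congr rfl fun i hi => if_pos ?_)
          (stdSimplex.map_apply_eq_sum (f.toOrderHom) t j).symm
        rwa [(Finset.mem_filter.1 hi).2]
      · refine Finset.sum_eq_zero fun i hi => if_neg ?_
        rwa [(Finset.mem_filter.1 hi).2])
  by_contra hne
  have h1 := congrArg ULift.down ((hg m x _).symm.trans ((congrArg g h).trans (hg m' x' _)))
  simp only [ContinuousMap.coe_mk, stdSimplex.vertex_coe] at h1
  rw [Finset.sum_eq_zero, Finset.sum_eq_single_of_mem k' (Finset.mem_univ _)] at h1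
  · simp at h1
  · intro j _ hj
    simp [hj]
  · intro j _
    rcases eq_or_ne j k with rfl | hj
    · rw [if_neg hne]
    · simp [hj]

/-- No edge between consecutive vertices is mapped to a point by the characteristic map. -/
def HasNonconstantEdges {n : ℕ} (y : X _⦋n⦌) : Prop :=
  ∀ i : Fin n, ∃ t : _root_.stdSimplex ℝ (Fin 2),
    X.chart y (stdSimplex.map ![i.castSucc, i.succ] t) ≠ X.chart y (stdSimplex.vertex i.castSucc)

/-- A degeneracy lowers the dimension, so it merges two consecutive vertices and makes the edge
between them constant. -/
theorem HasNonconstantEdges.mem_nonDegenerate {n : ℕ} {y : X _⦋n⦌} (hy : HasNonconstantEdges y) :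
    y ∈ X.nonDegenerate n := by
  rintro ⟨m, hm, f, z, rfl⟩
  obtain ⟨i, hi⟩ : ∃ i : Fin n, f.toOrderHom i.castSucc = f.toOrderHom i.succ := by
    by_contra! hne
    have hmono : StrictMono f.toOrderHom := Fin.strictMono_iff_lt_succ.2 fun i =>
      lt_of_le_of_ne (f.toOrderHom.monotone i.castSucc_le_succ) (hne i)
    have := Fintype.card_le_of_injective _ hmono.injective
    simp only [SimplexCategory.len_mk, Fintype.card_fin] at this
    omega
  obtain ⟨t, ht⟩ := hy i
  refine ht ?_
  have h1 : (f.toOrderHom : Fin (n + 1) → Fin (m + 1)) ∘ ![i.castSucc, i.succ] =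
      fun _ => f.toOrderHom i.castSucc := by
    funext j
    fin_cases j
    · rfl
    · exact hi.symm
  rw [chart_map, chart_map, stdSimplex.map_comp_apply, stdSimplex.map_vertex]
  refine congrArg (X.chart z) ?_
  exact (congrArg (fun g => stdSimplex.map g t) h1).trans (stdSimplex.map_const _ t)

theorem HasNonconstantEdges.map {m n : ℕ} {y : X _⦋n⦌} (hy : HasNonconstantEdges y)
    (f : ⦋m⦌ ⟶ ⦋n⦌) (hf : ∀ k : Fin (m + 1), (f.toOrderHom k : ℕ) = k) :
    HasNonconstantEdges (X.map f.op y) := by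
  intro i
  have hm : m < n + 1 := by
    have := (f.toOrderHom (Fin.last m)).2
    rwa [hf] at this
  obtain ⟨t, ht⟩ := hy ⟨i, by omega⟩
  refine ⟨t, fun h => ht ?_⟩
  have h0 : f.toOrderHom i.castSucc = (⟨i, by omega⟩ : Fin n).castSucc := Fin.ext (hf _)
  have h1 : (f.toOrderHom : Fin (m + 1) → Fin (n + 1)) ∘ ![i.castSucc, i.succ] =
      ![(⟨i, by omega⟩ : Fin n).castSucc, (⟨i, by omega⟩ : Fin n).succ] := by
    funext j
    fin_cases j
    · exact h0
    · exact Fin.ext (hf _)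
  rw [chart_map, chart_map, stdSimplex.map_comp_apply, stdSimplex.map_vertex] at h
  have h2 := congrArg (fun g => X.chart y (stdSimplex.map g t)) h1
  exact h2.symm.trans (h.trans (congrArg (fun k => X.chart y (stdSimplex.vertex k)) h0))

/-- Regularity protects only the last vertex of a nondegenerate simplex. It is applied to the front
face on the vertices `0, …, i + 1`, whose edges are still nonconstant and whose last vertex is the
one in question. -/
theorem HasNonconstantEdges.vtx_ne [X.IsRegular] {n : ℕ} {y : X _⦋n⦌} (hy : HasNonconstantEdges y)
    (i : Fin n) : vtx y i.castSucc ≠ vtx y i.succ := by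
  intro h
  let f : ⦋i + 1⦌ ⟶ ⦋n⦌ := SimplexCategory.mkHom
    ⟨fun k => ⟨k, by have := k.2; omega⟩, fun _ _ hk => hk⟩
  have hnd := (hy.map f fun _ => rfl).mem_nonDegenerate
  let j : Fin ((i : ℕ) + 1 + 1) := ⟨i, by omega⟩
  have hj : f.toOrderHom j = i.castSucc := rfl
  have hl : f.toOrderHom (Fin.last _) = i.succ := rfl
  have h' : vtx (X.map f.op y) j = vtx (X.map f.op y) (Fin.last _) := by
    rw [vtx_map, vtx_map, hj, hl, h]
  rcases IsRegular.eq_or_lastFace _ hnd _ _ h' with h1 | h1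
  · have := congrArg (fun g => ((g : ⦋0⦌ ⟶ ⦋i + 1⦌).toOrderHom 0 : Fin (i + 2))) h1
    have := congrArg Fin.val this
    simp [j] at this
  · exact h1.2 0 rfl

theorem two_pow_le_encard_nonDegenerate [X.IsRegular] {n : ℕ}
    (h : Nonempty (SSet.toTop.obj X ≃ₜ Torus n) ∨
      Nonempty (SSet.toTop.obj X ≃ₜ RealProjectiveSpace n)) :
    (2 ^ n : ℕ∞) ≤ (X.nonDegenerate n).encard := by
  rcases (X.nonDegenerate n).finite_or_infinite with hfin | hinf
  swap
  · rw [hinf.encard_eq]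
    exact le_top
  have hfin' : {y : X _⦋n⦌ | HasNonconstantEdges y}.Finite :=
    hfin.subset fun y hy => HasNonconstantEdges.mem_nonDegenerate hy
  have key := (atlas X).two_pow_le_card_of_homeomorph h hfin'.toFinset (fun y => X.chart y)
    (fun y hy i hi => ((hfin'.mem_toFinset.1 hy : HasNonconstantEdges y).vtx_ne i)
      (vtx_eq_of_chart_eq hi)) ?_
  · refine le_trans ?_ (Set.encard_le_encard
      (fun y hy => HasNonconstantEdges.mem_nonDegenerate hy :
        {y : X _⦋n⦌ | HasNonconstantEdges y} ⊆ X.nonDegenerate n))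
    rw [hfin'.encard_eq_coe_toFinset_card]
    exact_mod_cast key
  · rintro ⟨m, x⟩ w hw hedge
    let f : ⦋n⦌ ⟶ ⦋m⦌ := SimplexCategory.mkHom ⟨w, hw.monotone⟩
    refine ⟨X.map f.op x, hfin'.mem_toFinset.2 fun i => ?_, fun t => chart_map f x t⟩
    obtain ⟨t, ht⟩ := hedge i
    refine ⟨t, fun h => ht ?_⟩
    rw [chart_map, chart_map, stdSimplex.map_comp_apply, stdSimplex.map_vertex] at h
    have h1 : w ∘ ![i.castSucc, i.succ] = ![w i.castSucc, w i.succ] := by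
      funext j
      fin_cases j <;> rfl
    have h2 := congrArg (fun g => X.chart x (stdSimplex.map g t)) h1
    exact h2.symm.trans h

end SSet

/-! ### The boundary of the crosspolytope -/

theorem continuous_sum_abs (d : ℕ) : Continuous fun v : Fin d → ℝ => ∑ i, abs (v i) :=
  continuous_finsetSum _ fun i _ => (continuous_apply i).abs

theorem crosspolytope_eq (n : ℕ) :
    crosspolytope (n + 1) = {v | ∑ i, abs (v i) ≤ 1} := by
  refine Set.Subset.antisymm (convexHull_min ?_ ?_) ?_
  · rintro v ⟨i, rfl | rfl⟩
    · simp [Pi.single_apply, apply_ite abs]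
    · simp [Pi.single_apply, apply_ite abs]
  · intro x hx y hy a b ha hb hab
    calc ∑ i, abs ((a • x + b • y) i) ≤ ∑ i, (a * abs (x i) + b * abs (y i)) :=
          Finset.sum_le_sum fun i _ => (abs_add_le _ _).trans_eq (by
            simp [abs_mul, abs_of_nonneg ha, abs_of_nonneg hb])
      _ = a * ∑ i, abs (x i) + b * ∑ i, abs (y i) := by
          rw [Finset.sum_add_distrib, Finset.mul_sum, Finset.mul_sum]
      _ ≤ a * 1 + b * 1 := add_le_add (mul_le_mul_of_nonneg_left hx ha)
          (mul_le_mul_of_nonneg_left hy hb)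
      _ = 1 := by rw [mul_one, mul_one, hab]
  · intro v hv
    have hconv : Convex ℝ (crosspolytope (n + 1)) := convex_convexHull ℝ _
    have hpos (i) : (Pi.single i 1 : Fin (n + 1) → ℝ) ∈ crosspolytope (n + 1) :=
      subset_convexHull ℝ _ ⟨i, Or.inl rfl⟩
    have hneg (i) : (-Pi.single i 1 : Fin (n + 1) → ℝ) ∈ crosspolytope (n + 1) :=
      subset_convexHull ℝ _ ⟨i, Or.inr rfl⟩
    have h0 : (0 : Fin (n + 1) → ℝ) ∈ crosspolytope (n + 1) := by
      have := hconv (hpos 0) (hneg 0) (a := 1 / 2) (b := 1 / 2) (by norm_num) (by norm_num)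
        (by norm_num)
      simpa using this
    rcases (Finset.sum_nonneg fun i _ => abs_nonneg (v i) : 0 ≤ ∑ i, abs (v i)).eq_or_lt' with h | h
    · have : v = 0 := by
        funext i
        exact abs_eq_zero.1 ((Finset.sum_eq_zero_iff_of_nonneg fun i _ => abs_nonneg (v i)).1 h i
          (Finset.mem_univ i))
      rwa [this]
    · have h1 := hconv.sum_mem (t := Finset.univ) (w := fun i => abs (v i) / ∑ j, abs (v j))
        (z := fun i => if 0 ≤ v i then Pi.single i 1 else -Pi.single i 1)
        (fun i _ => by positivity) (by rw [← Finset.sum_div, div_self h.ne'])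
        (fun i _ => by split_ifs; exacts [hpos i, hneg i])
      -- Up to the factor `∑ |vᵢ| ≤ 1`, `v` is a convex combination of the vertices of its orthant.
      have h2 := hconv.smul_mem_of_zero_mem h0 h1 ⟨h.le, hv⟩
      convert h2 using 1
      rw [Finset.smul_sum]
      funext i
      rw [Finset.sum_apply, Finset.sum_eq_single_of_mem i (Finset.mem_univ _)]
      · simp only [Pi.smul_apply, smul_eq_mul]
        split_ifs with hi
        · rw [Pi.single_eq_same, mul_one, mul_div_cancel₀ _ h.ne', abs_of_nonneg hi]
        · rw [Pi.neg_apply, Pi.single_eq_same, ← mul_assoc, mul_div_cancel₀ _ h.ne',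
            abs_of_neg (not_le.1 hi)]
          ring
      · intro j _ hj
        split_ifs <;> simp [hj.symm]

theorem frontier_crosspolytope (n : ℕ) :
    frontier (crosspolytope (n + 1)) = {v | ∑ i, abs (v i) = 1} := by
  rw [crosspolytope_eq]
  refine Set.Subset.antisymm (frontier_le_subset_eq (continuous_sum_abs _) continuous_const) ?_
  intro v hv
  rw [frontier_eq_closure_inter_closure]
  refine ⟨subset_closure (le_of_eq hv), ?_⟩
  have hlim : Filter.Tendsto (fun k : ℕ => (1 + 1 / ((k : ℝ) + 1)) • v) Filter.atTop
      (nhds ((1 + 0 : ℝ) • v)) :=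
    (tendsto_const_nhds.add tendsto_one_div_add_atTop_nhds_zero_nat).smul_const v
  rw [add_zero, one_smul] at hlim
  refine mem_closure_of_tendsto hlim (Filter.Eventually.of_forall fun k hk => ?_)
  have hk0 : (0 : ℝ) < 1 / ((k : ℝ) + 1) := by positivity
  have h1 : ∑ i, abs (((1 + 1 / ((k : ℝ) + 1)) • v) i) = 1 + 1 / ((k : ℝ) + 1) := by
    simp only [Pi.smul_apply, smul_eq_mul, abs_mul]
    rw [← Finset.mul_sum, show ∑ i, abs (v i) = 1 from hv, mul_one, abs_of_pos (by positivity)]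
  have h2 : ∑ i, abs (((1 + 1 / ((k : ℝ) + 1)) • v) i) ≤ 1 := hk
  linarith

namespace CrossVertex

variable {n : ℕ}

theorem eq_of_le_of_index_eq {a b : CrossVertex n} (h : a ≤ b) (hi : a.index = b.index) : a = b := by
  rcases h with h | h
  · exact h
  · exact absurd hi h.ne

theorem eq_of_index_eq {m : ℕ} (x : (crossBoundary n) _⦋m⦌) {k k' : Fin (m + 1)}
    (h : (x.obj k).index = (x.obj k').index) : x.obj k = x.obj k' := by
  rcases le_total k k' with hk | hk
  · exact eq_of_le_of_index_eq (x.monotone hk) h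
  · exact (eq_of_le_of_index_eq (x.monotone hk) h.symm).symm

theorem index_monotone : Monotone (index : CrossVertex n → Fin (n + 1)) := by
  rintro a b (rfl | h)
  · exact le_rfl
  · exact h.le

end CrossVertex

namespace crossBoundary

variable {n : ℕ}

/-- The facet of the boundary of the crosspolytope in an orthant. -/
def facet (ε : Fin (n + 1) → ℤˣ) : (crossBoundary n) _⦋n⦌ :=
  Monotone.functor (f := fun i => (⟨i, ε i⟩ : CrossVertex n)) fun i j hij => by
    rcases hij.eq_or_lt with rfl | h
    · exact le_rfl
    · exact Or.inr h

theorem facet_obj (ε : Fin (n + 1) → ℤˣ) (i : Fin (n + 1)) : (facet ε).obj i = ⟨i, ε i⟩ := rfl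

theorem ext_obj {m : ℕ} {x y : (crossBoundary n) _⦋m⦌} (h : ∀ k, x.obj k = y.obj k) : x = y :=
  CategoryTheory.Functor.ext h fun _ _ _ => Subsingleton.elim _ _

/-- The dimensions in which a simplex extends, as a map to the standard simplex. -/
def indexHom {m : ℕ} (x : (crossBoundary n) _⦋m⦌) : ⦋m⦌ ⟶ ⦋n⦌ :=
  SimplexCategory.mkHom ⟨fun k => (x.obj k).index, fun _ _ h => CrossVertex.index_monotone (x.monotone h)⟩

theorem exists_eq_map_facet {m : ℕ} (x : (crossBoundary n) _⦋m⦌) :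
    ∃ ε, x = (crossBoundary n).map (indexHom x).op (facet ε) := by
  classical
  refine ⟨fun i => if h : ∃ k, (x.obj k).index = i then (x.obj h.choose).sign else 1,
    ext_obj fun k => ?_⟩
  have h : ∃ k', (x.obj k').index = (x.obj k).index := ⟨k, rfl⟩
  refine CrossVertex.ext rfl ?_
  change _ = (if h : ∃ k', (x.obj k').index = (x.obj k).index then _ else _)
  rw [dif_pos h]
  exact congrArg CrossVertex.sign (CrossVertex.eq_of_index_eq x h.choose_spec).symm

theorem exists_chart_facet_eq (p : SSet.toTop.obj (crossBoundary n)) :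
    ∃ ε t, (crossBoundary n).chart (facet ε) t = p := by
  obtain ⟨m, x, t, rfl⟩ := SSet.exists_chart_eq p
  obtain ⟨ε, hε⟩ := exists_eq_map_facet x
  refine ⟨ε, stdSimplex.map (indexHom x) t, ?_⟩
  rw [← SSet.chart_map, ← hε]

/-- The point lies in the face spanned by its nonzero coordinates, which the two facets share. -/
theorem chart_facet_congr {ε ε' : Fin (n + 1) → ℤˣ} (t : stdSimplex ℝ (Fin (n + 1)))
    (h : ∀ i, t i ≠ 0 → ε i = ε' i) :
    (crossBoundary n).chart (facet ε) t = (crossBoundary n).chart (facet ε') t := by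
  classical
  let s := Finset.univ.filter fun i => t i ≠ 0
  have hs : s.Nonempty := by
    rw [Finset.nonempty_iff_ne_empty]
    intro hs
    have h1 := stdSimplex.sum_eq_one t
    rw [Finset.sum_eq_zero fun i hi => not_not.1 fun h => (Finset.filter_eq_empty_iff.1 hs) hi h] at h1
    exact zero_ne_one h1
  have hc : s.card = s.card - 1 + 1 := (Nat.sub_add_cancel (Finset.card_pos.2 hs)).symm
  let e := s.orderEmbOfFin hc
  let θ : ⦋s.card - 1⦌ ⟶ ⦋n⦌ := SimplexCategory.mkHom e.toOrderHom
  have hsum (f : Fin (n + 1) → ℝ) : ∑ k, f (e k) = ∑ i ∈ s, f i := by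
    refine (Finset.sum_map Finset.univ e.toEmbedding f).symm.trans ?_
    rw [Finset.map_orderEmbOfFin_univ]
  let u : stdSimplex ℝ (Fin (s.card - 1 + 1)) := ⟨fun k => t (e k), fun k => t.2.1 _, by
    rw [hsum fun i => t i, ← stdSimplex.sum_eq_one t]
    exact Finset.sum_subset (Finset.subset_univ _) fun i _ hi => by simpa [s] using hi⟩
  have hu : stdSimplex.map θ u = t := by
    refine stdSimplex.ext (funext fun i => ?_)
    rw [stdSimplex.map_apply_eq_sum]
    by_cases hi : t i = 0
    · rw [hi]
      refine Finset.sum_eq_zero fun k hk => ?_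
      have : e k = i := (Finset.mem_filter.1 hk).2
      exact (congrArg t this).trans hi
    · obtain ⟨k, hk⟩ : i ∈ Set.range e := by
        rw [Finset.range_orderEmbOfFin]
        simpa [s] using hi
      rw [Finset.sum_eq_single_of_mem k (Finset.mem_filter.2 ⟨Finset.mem_univ _, hk⟩)]
      · exact congrArg t hk
      · intro k' hk' hne
        exact absurd (e.injective ((Finset.mem_filter.1 hk').2.trans hk.symm)) hne
  rw [← hu, ← SSet.chart_map, ← SSet.chart_map]
  congr 1
  refine congrArg _ (ext_obj fun k => ?_)
  have : e k ∈ s := s.orderEmbOfFin_mem hc k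
  exact CrossVertex.ext rfl (h _ (Finset.mem_filter.1 this).2)

instance : CompactSpace (SSet.toTop.obj (crossBoundary n)) := by
  have h : (Set.univ : Set (SSet.toTop.obj (crossBoundary n))) =
      ⋃ ε : Fin (n + 1) → ℤˣ, Set.range ((crossBoundary n).chart (facet ε)) := by
    symm
    rw [Set.eq_univ_iff_forall]
    intro p
    obtain ⟨ε, t, rfl⟩ := exists_chart_facet_eq p
    exact Set.mem_iUnion.2 ⟨ε, t, rfl⟩
  rw [← isCompact_univ_iff, h]
  exact isCompact_iUnion fun ε => isCompact_range (ContinuousMap.continuous _)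

end crossBoundary

/-! ### The simplices of the antipodal quotient -/

namespace crossQuotient

variable {n : ℕ}

/-- The class of a simplex of the boundary of the crosspolytope. -/
def mk {m : ℕ} (y : (crossBoundary n) _⦋m⦌) : (crossQuotient n) _⦋m⦌ := Quot.mk _ y

theorem exists_mk {m : ℕ} (x : (crossQuotient n) _⦋m⦌) : ∃ y, mk y = x := Quot.exists_rep x

theorem mk_antipode {m : ℕ} (y : (crossBoundary n) _⦋m⦌) :
    mk ((crossAntipode n).app _ y) = mk y :=
  (Quot.sound (r := fun x y => y = (crossAntipode n).app (op ⦋m⦌) x) rfl).symm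

/-- The dimensions in which a simplex of the quotient extends. -/
def index {m : ℕ} : (crossQuotient n) _⦋m⦌ → Fin (m + 1) → Fin (n + 1) :=
  Quot.lift (fun y k => (y.obj k).index) (by rintro x _ rfl; rfl)

/-- The signs of the vertices of a simplex, relative to the sign of its first vertex. -/
def relSign {m : ℕ} : (crossQuotient n) _⦋m⦌ → Fin (m + 1) → ℤˣ :=
  Quot.lift (fun y k => (y.obj k).sign * (y.obj 0).sign) (by
    rintro x _ rfl
    funext k
    exact (neg_mul_neg _ _).symm)

theorem index_map {m m' : ℕ} (f : ⦋m'⦌ ⟶ ⦋m⦌) (x : (crossQuotient n) _⦋m⦌) (k : Fin (m' + 1)) :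
    index ((crossQuotient n).map f.op x) k = index x (f.toOrderHom k) := by
  obtain ⟨y, rfl⟩ := exists_mk x
  rfl

theorem mem_nonDegenerate_iff {m : ℕ} (x : (crossQuotient n) _⦋m⦌) :
    x ∈ (crossQuotient n).nonDegenerate m ↔ Function.Injective (index x) := by
  constructor
  · obtain ⟨y, rfl⟩ := exists_mk x
    intro hx k k' hk
    have hy : y ∈ (crossBoundary n).nonDegenerate m := by
      rintro ⟨m', hm', f, z, rfl⟩
      exact hx ⟨m', hm', f, mk z, rfl⟩
    exact (PartialOrder.mem_nerve_nonDegenerate_iff_injective y).1 hy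
      (CrossVertex.eq_of_index_eq y hk)
  · rintro hx ⟨m', hm', f, z, rfl⟩
    have hf : Function.Injective f.toOrderHom := fun k k' h => hx (by
      rw [index_map, index_map, h])
    have := Fintype.card_le_of_injective _ hf
    simp only [SimplexCategory.len_mk, Fintype.card_fin] at this
    omega

/-- The index is natural and injective on the vertices of a nondegenerate simplex, so a simplex of
the standard simplex is recovered from its image. -/
instance : (crossQuotient n).Nonsingular where
  mono := by
    intro m ⟨x, hx⟩
    rw [mem_nonDegenerate_iff] at hx
    simp only [NatTrans.mono_iff_mono_app, mono_iff_injective]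
    intro ⟨⟨k⟩⟩ f g h
    obtain ⟨f, rfl⟩ := SSet.stdSimplex.objEquiv.symm.surjective f
    obtain ⟨g, rfl⟩ := SSet.stdSimplex.objEquiv.symm.surjective g
    have h : (crossQuotient n).map f.op x = (crossQuotient n).map g.op x := h
    refine congrArg _ (SimplexCategory.Hom.ext _ _ (OrderHom.ext _ _ (funext fun l => hx ?_)))
    rw [← index_map, ← index_map, h]

/-- The indices of a nondegenerate `n`-simplex are all of `0, …, n` in order, so it is the class of
a facet; the antipodal map normalizes the first sign to `1`. -/
theorem range_facet :
    Set.range (fun ε : Fin n → ℤˣ => mk (crossBoundary.facet (Fin.cons 1 ε))) =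
      (crossQuotient n).nonDegenerate n := by
  refine Set.Subset.antisymm ?_ fun x => ?_
  · rintro _ ⟨ε, rfl⟩
    exact (mem_nonDegenerate_iff _).2 Function.injective_id
  · rw [mem_nonDegenerate_iff]
    obtain ⟨y, rfl⟩ := exists_mk x
    intro hy
    have hmono : StrictMono fun k => (y.obj k).index :=
      (show Monotone fun k => (y.obj k).index from
        fun _ _ h => CrossVertex.index_monotone (y.monotone h)).strictMono_of_injective hy
    have hid : (fun k => (y.obj k).index) = id := by
      refine (hmono.range_inj strictMono_id).1 ?_
      rw [Set.range_id, Set.range_eq_univ]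
      exact Finite.surjective_of_injective hy
    have key (z : (crossBoundary n) _⦋n⦌) (hz : ∀ k, (z.obj k).index = k)
        (h0 : (z.obj 0).sign = 1) :
        z = crossBoundary.facet (Fin.cons 1 fun i => (z.obj i.succ).sign) := by
      refine crossBoundary.ext_obj fun k => CrossVertex.ext (hz k) ?_
      induction k using Fin.cases with
      | zero => exact h0
      | succ i => rfl
    rcases Int.units_eq_one_or (y.obj 0).sign with h0 | h0
    · exact ⟨_, congrArg _ (key y (congrFun hid) h0).symm⟩
    · refine ⟨fun i => -(y.obj i.succ).sign, ?_⟩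
      have h := key ((crossAntipode n).app _ y) (congrFun hid) (by
        change -(y.obj 0).sign = 1
        rw [h0, neg_neg])
      exact (congrArg mk h.symm).trans (mk_antipode y)

/-- Signs relative to the first vertex are antipodally invariant and recover `ε`. -/
theorem encard_nonDegenerate : ((crossQuotient n).nonDegenerate n).encard = 2 ^ n := by
  have hinj : Function.Injective (fun ε : Fin n → ℤˣ =>
      mk (crossBoundary.facet (Fin.cons 1 ε))) := by
    intro ε ε' h
    funext i
    have h1 := congrFun (congrArg relSign h) i.succ
    change Fin.cons (α := fun _ => ℤˣ) 1 ε i.succ * Fin.cons (α := fun _ => ℤˣ) 1 ε 0 =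
      Fin.cons (α := fun _ => ℤˣ) 1 ε' i.succ * Fin.cons (α := fun _ => ℤˣ) 1 ε' 0 at h1
    simpa using h1
  rw [← range_facet, ← Set.image_univ, hinj.encard_image, Set.encard_univ,
    ENat.card_eq_coe_fintype_card, Fintype.card_fun, Fintype.card_units_int, Fintype.card_fin]
  push_cast
  rfl

end crossQuotient

/-! ### The homeomorphisms `Φ` and `Ψ` -/

theorem sum_abs_of_mem_frontier_crosspolytope {n : ℕ} {v : Fin (n + 1) → ℝ}
    (hv : v ∈ frontier (crosspolytope (n + 1))) : ∑ i, abs (v i) = 1 := by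
  rwa [frontier_crosspolytope] at hv

theorem ne_zero_of_mem_frontier_crosspolytope {n : ℕ} {v : Fin (n + 1) → ℝ}
    (hv : v ∈ frontier (crosspolytope (n + 1))) : v ≠ 0 := by
  rintro rfl
  simpa using sum_abs_of_mem_frontier_crosspolytope hv

namespace crossBoundary

variable {n : ℕ}

theorem continuous_sum_smul_vec {m : ℕ} (x : (crossBoundary n) _⦋m⦌) :
    Continuous fun t : stdSimplex ℝ (Fin (m + 1)) => ∑ k, t k • (x.obj k).vec :=
  continuous_finsetSum _ fun k _ =>
    ((continuous_apply k).comp continuous_subtype_val).smul continuous_const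

theorem exists_affine_map (n : ℕ) :
    ∃ g : C(SSet.toTop.obj (crossBoundary n), Fin (n + 1) → ℝ),
      ∀ (m : ℕ) (x : (crossBoundary n) _⦋m⦌) (t : stdSimplex ℝ (Fin (m + 1))),
        g ((crossBoundary n).chart x t) = ∑ k, t k • (x.obj k).vec := by
  obtain ⟨g, hg⟩ := SSet.exists_hom_of_chart (X := crossBoundary n)
    (Y := TopCat.of (Fin (n + 1) → ℝ))
    (fun m x => ⟨fun t => ∑ k, t k • (x.obj k).vec, continuous_sum_smul_vec x⟩)
    (fun m m' f x t => by
      change ∑ k, t k • (x.obj (f.toOrderHom k)).vec =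
        ∑ k, stdSimplex.map f.toOrderHom t k • (x.obj k).vec
      rw [← Finset.sum_fiberwise (g := f.toOrderHom)]
      refine Finset.sum_congr rfl fun j _ => ?_
      rw [stdSimplex.map_apply_eq_sum, Finset.sum_smul]
      exact Finset.sum_congr rfl fun i hi => by rw [(Finset.mem_filter.1 hi).2])
  exact ⟨g.hom, hg⟩

theorem sum_smul_vec_facet (ε : Fin (n + 1) → ℤˣ) (t : Fin (n + 1) → ℝ) (i : Fin (n + 1)) :
    (∑ k, t k • ((facet ε).obj k).vec) i = t i * ((ε i : ℤ) : ℝ) := by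
  rw [Finset.sum_apply, Finset.sum_eq_single_of_mem i (Finset.mem_univ _)]
  · simp [facet_obj, CrossVertex.vec]
  · intro k _ hk
    simp [facet_obj, CrossVertex.vec, hk.symm]

theorem abs_mul_units (a : ℝ) (s : ℤˣ) : abs (a * ((s : ℤ) : ℝ)) = abs a := by
  rcases Int.units_eq_one_or s with rfl | rfl <;> simp

/-- The realization of the boundary of the crosspolytope as a simplicial set is its boundary. -/
theorem exists_homeomorph_frontier (n : ℕ) :
    ∃ Φ : SSet.toTop.obj (crossBoundary n) ≃ₜ frontier (crosspolytope (n + 1)),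
      ∀ (m : ℕ) (x : (crossBoundary n) _⦋m⦌) (t : stdSimplex ℝ (Fin (m + 1))),
        (Φ ((crossBoundary n).chart x t) : Fin (n + 1) → ℝ) = ∑ k, t k • (x.obj k).vec := by
  obtain ⟨g, hg⟩ := exists_affine_map n
  have hfacet (ε : Fin (n + 1) → ℤˣ) (t : stdSimplex ℝ (Fin (n + 1))) (i) :
      g ((crossBoundary n).chart (facet ε) t) i = t i * ((ε i : ℤ) : ℝ) := by
    rw [hg]
    exact sum_smul_vec_facet ε t i
  have hmem (p) : g p ∈ frontier (crosspolytope (n + 1)) := by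
    obtain ⟨ε, t, rfl⟩ := exists_chart_facet_eq p
    rw [frontier_crosspolytope, Set.mem_ofPred_eq]
    simp only [hfacet, abs_mul_units]
    exact (Finset.sum_congr rfl fun i _ => abs_of_nonneg (t.2.1 i)).trans
      (stdSimplex.sum_eq_one t)
  have hinj : Function.Injective g := by
    intro p q h
    obtain ⟨ε, t, rfl⟩ := exists_chart_facet_eq p
    obtain ⟨ε', t', rfl⟩ := exists_chart_facet_eq q
    have h1 (i) : t i * ((ε i : ℤ) : ℝ) = t' i * ((ε' i : ℤ) : ℝ) := by
      rw [← hfacet, ← hfacet, h]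
    obtain rfl : t = t' := by
      refine stdSimplex.ext (funext fun i => ?_)
      have h2 := congrArg abs (h1 i)
      rw [abs_mul_units, abs_mul_units] at h2
      exact (abs_of_nonneg (t.2.1 i)).symm.trans (h2.trans (abs_of_nonneg (t'.2.1 i)))
    refine chart_facet_congr t fun i hi => ?_
    have h2 := mul_left_cancel₀ hi (h1 i)
    exact Units.ext (by exact_mod_cast h2)
  have hsurj (y : frontier (crosspolytope (n + 1))) : ∃ p, g p = y.1 := by
    have hy := sum_abs_of_mem_frontier_crosspolytope y.2
    refine ⟨(crossBoundary n).chart (facet fun i => if 0 ≤ y.1 i then 1 else -1)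
      ⟨fun i => abs (y.1 i), fun i => abs_nonneg _, hy⟩, funext fun i => ?_⟩
    rw [hfacet]
    change abs (y.1 i) * _ = _
    split_ifs with h
    · simp [abs_of_nonneg h]
    · simp [abs_of_neg (not_le.1 h)]
  let e : SSet.toTop.obj (crossBoundary n) ≃ frontier (crosspolytope (n + 1)) :=
    Equiv.ofBijective (fun p => ⟨g p, hmem p⟩)
      ⟨fun p q h => hinj (congrArg Subtype.val h),
        fun y => (hsurj y).imp fun p hp => Subtype.ext hp⟩
  have he : Continuous e := g.continuous.subtype_mk hmem
  exact ⟨he.homeoOfEquivCompactToT2, hg⟩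

theorem sum_smul_vec_antipode {m : ℕ} (x : (crossBoundary n) _⦋m⦌) (t : Fin (m + 1) → ℝ) :
    ∑ k, t k • (((crossAntipode n).app _ x).obj k).vec = -∑ k, t k • (x.obj k).vec := by
  rw [← Finset.sum_neg_distrib]
  refine Finset.sum_congr rfl fun k _ => ?_
  rw [← smul_neg]
  congr 1
  have : (((-(x.obj k).sign : ℤˣ) : ℤ) : ℝ) = -(((x.obj k).sign : ℤ) : ℝ) := by push_cast; rfl
  exact (congrArg _ this).trans (Pi.single_neg _ _)

end crossBoundary

/-- A line is determined by its orthogonal projection, which depends continuously on it. -/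
instance RealProjectiveSpace.t2Space (n : ℕ) : T2Space (RealProjectiveSpace n) :=
  T2Space.of_injective_continuous (f := RealProjectiveSpace.proj) (by
    intro p q
    induction p using RealProjectiveSpace.ind with | _ v hv =>
    induction q using RealProjectiveSpace.ind with | _ w hw =>
    intro h
    rw [RealProjectiveSpace.proj_mk, RealProjectiveSpace.proj_mk] at h
    have h1 := congrArg (fun A => A (WithLp.toLp 2 v)) h
    simp only [spanProj_apply] at h1
    rw [inv_mul_cancel₀ (by simpa using hv), one_smul] at h1
    exact (RealProjectiveSpace.mk_eq_mk_iff _ _).2 ⟨_, (congrArg WithLp.ofLp h1).symm⟩)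
    RealProjectiveSpace.isLineField_proj.continuous

namespace crossQuotient

theorem exists_homeomorph_realProjectiveSpace {n : ℕ}
    (Φ : SSet.toTop.obj (crossBoundary n) ≃ₜ frontier (crosspolytope (n + 1)))
    (hΦ : ∀ (m : ℕ) (x : (crossBoundary n) _⦋m⦌) (t : stdSimplex ℝ (Fin (m + 1))),
        (Φ ((crossBoundary n).chart x t) : Fin (n + 1) → ℝ) = ∑ k, t k • (x.obj k).vec) :
    ∃ Ψ : SSet.toTop.obj (crossQuotient n) ≃ₜ RealProjectiveSpace n,
      ∀ p, (Ψ (SSet.toTop.map (crossQuotientMap n) p)).line =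
        Submodule.span ℝ {(Φ p : Fin (n + 1) → ℝ)} := by
  have hne (p) : (Φ p : Fin (n + 1) → ℝ) ≠ 0 := ne_zero_of_mem_frontier_crosspolytope (Φ p).2
  have hanti {m : ℕ} (x : (crossBoundary n) _⦋m⦌) (t) :
      (Φ ((crossBoundary n).chart ((crossAntipode n).app _ x) t) : Fin (n + 1) → ℝ) =
        -Φ ((crossBoundary n).chart x t) := by
    rw [hΦ, hΦ]
    exact crossBoundary.sum_smul_vec_antipode x t
  let μ : C(SSet.toTop.obj (crossBoundary n), RealProjectiveSpace n) :=
    ⟨fun p => RealProjectiveSpace.mk (Φ p).1 (hne p), RealProjectiveSpace.continuous_mk.comp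
      ((continuous_subtype_val.comp Φ.continuous).subtype_mk hne)⟩
  obtain ⟨g, hg⟩ := SSet.exists_hom_of_chart (X := crossQuotient n)
    (Y := TopCat.of (RealProjectiveSpace n))
    (fun m => Quot.lift (fun y => μ.comp ((crossBoundary n).chart y)) (by
      rintro x _ rfl
      ext t : 1
      refine (RealProjectiveSpace.mk_eq_mk_iff _ _).2 ⟨-1, ?_⟩
      rw [hanti, neg_smul, one_smul, neg_neg]))
    (fun m m' f x t => by
      obtain ⟨y, rfl⟩ := exists_mk x
      exact congrArg μ (SSet.chart_map f y t))
  let π := SSet.toTop.map (crossQuotientMap n)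
  have hπ {m : ℕ} (x : (crossBoundary n) _⦋m⦌) (t) :
      π ((crossBoundary n).chart x t) = (crossQuotient n).chart (mk x) t :=
    SSet.toTop_map_chart (crossQuotientMap n) x t
  have hgπ (p) : g (π p) = μ p := by
    obtain ⟨m, x, t, rfl⟩ := SSet.exists_chart_eq p
    rw [hπ, hg]
    rfl
  have hπsurj : Function.Surjective π := by
    intro q
    obtain ⟨m, x, t, rfl⟩ := SSet.exists_chart_eq q
    obtain ⟨y, rfl⟩ := exists_mk x
    exact ⟨_, hπ y t⟩
  have : CompactSpace (SSet.toTop.obj (crossQuotient n)) :=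
    hπsurj.compactSpace π.hom.continuous
  have hinj : Function.Injective g := by
    intro q q' h
    obtain ⟨p, rfl⟩ := hπsurj q
    obtain ⟨p', rfl⟩ := hπsurj q'
    rw [hgπ, hgπ] at h
    obtain ⟨c, hc⟩ := (RealProjectiveSpace.mk_eq_mk_iff _ _).1 h
    have h1 := sum_abs_of_mem_frontier_crosspolytope (Φ p).2
    have h2 := sum_abs_of_mem_frontier_crosspolytope (Φ p').2
    rw [← hc] at h1
    simp only [Pi.smul_apply, smul_eq_mul, abs_mul] at h1
    rw [← Finset.mul_sum, h2, mul_one] at h1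
    -- Two boundary points on one line have equal `ℓ¹`-norm, hence are equal or antipodal.
    rcases eq_or_eq_neg_of_abs_eq h1 with rfl | rfl
    · rw [one_smul] at hc
      rw [Φ.injective (Subtype.ext hc)]
    · obtain ⟨m, x, t, rfl⟩ := SSet.exists_chart_eq p'
      have : p = (crossBoundary n).chart ((crossAntipode n).app _ x) t := by
        refine Φ.injective (Subtype.ext ?_)
        rw [hanti, ← hc, neg_smul, one_smul]
      rw [this, hπ, hπ]
      rw [mk_antipode]
  have hsurj : Function.Surjective g := by
    intro q
    induction q using RealProjectiveSpace.ind with | _ v hv =>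
    have hpos : 0 < ∑ i, abs (v i) := by
      obtain ⟨i, hi⟩ := Function.ne_iff.1 hv
      exact Finset.sum_pos' (fun i _ => abs_nonneg _) ⟨i, Finset.mem_univ _, abs_pos.2 hi⟩
    have hmem : (∑ i, abs (v i))⁻¹ • v ∈ frontier (crosspolytope (n + 1)) := by
      rw [frontier_crosspolytope, Set.mem_ofPred_eq]
      simp only [Pi.smul_apply, smul_eq_mul, abs_mul, abs_of_pos (inv_pos.2 hpos)]
      rw [← Finset.mul_sum, inv_mul_cancel₀ hpos.ne']
    obtain ⟨p, hp⟩ := Φ.surjective ⟨_, hmem⟩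
    refine ⟨π p, (hgπ p).trans ((RealProjectiveSpace.mk_eq_mk_iff _ _).2
      ⟨(∑ i, abs (v i))⁻¹, ?_⟩)⟩
    rw [hp]
  have hcont : Continuous (Equiv.ofBijective g ⟨hinj, hsurj⟩) := g.hom.continuous
  refine ⟨hcont.homeoOfEquivCompactToT2, fun p => ?_⟩
  exact (congrArg RealProjectiveSpace.line (hgπ p)).trans (RealProjectiveSpace.line_mk _ _)

end crossQuotient

theorem mainTheorem4 (n : ℕ) :
    -- Lower bound for simplicial complexes.
    (∀ (V : Type v) (K : AbstractSimplicialComplex V),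
      (Nonempty (K.Realization ≃ₜ Torus n) ∨ Nonempty (K.Realization ≃ₜ RealProjectiveSpace n)) →
        (2 ^ n : ℕ∞) ≤ (K.facesOfDim n).encard) ∧
    -- Lower bound for regular simplicial sets.
    (∀ (X : SSet.{u}) [X.IsRegular],
      (Nonempty (SSet.toTop.obj X ≃ₜ Torus n) ∨
        Nonempty (SSet.toTop.obj X ≃ₜ RealProjectiveSpace n)) →
        (2 ^ n : ℕ∞) ≤ (X.nonDegenerate n).encard) ∧
    -- Sharpness for `ℝPⁿ`: the antipodal quotient of the boundary of the crosspolytope.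
    (crossQuotient n).IsRegular ∧
    (crossQuotient n).Nonsingular ∧
    (∃ (Φ : SSet.toTop.obj (crossBoundary n) ≃ₜ frontier (crosspolytope (n + 1)))
       (Ψ : SSet.toTop.obj (crossQuotient n) ≃ₜ RealProjectiveSpace n),
      (∀ (m : ℕ) (x : (crossBoundary n) _⦋m⦌) (t : stdSimplex ℝ (Fin (m + 1))),
        (Φ ((crossBoundary n).realizationPoint x t) : Fin (n + 1) → ℝ) =
          ∑ k, t k • (x.obj k).vec) ∧
      (∀ p : SSet.toTop.obj (crossBoundary n),
        (Ψ (SSet.toTop.map (crossQuotientMap n) p)).line =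
          Submodule.span ℝ {(Φ p : Fin (n + 1) → ℝ)})) ∧
    ((crossQuotient n).nonDegenerate n).encard = 2 ^ n := by
  obtain ⟨Φ, hΦ⟩ := crossBoundary.exists_homeomorph_frontier n
  obtain ⟨Ψ, hΨ⟩ := crossQuotient.exists_homeomorph_realProjectiveSpace Φ hΦ
  exact ⟨fun V K h => K.two_pow_le_encard_facesOfDim h,
    fun X _ h => X.two_pow_le_encard_nonDegenerate h, SSet.IsRegular.of_nonsingular _,
    inferInstance,
    ⟨Φ, Ψ, fun m x t => by rw [SSet.realizationPoint_eq_chart, hΦ], hΨ⟩,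
    crossQuotient.encard_nonDegenerate⟩
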